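/- **Setting.** A rational number is represented as a pair $(a,b)$ of integers written in binary, $b\neq 0$, standing for $a/b$ (not necessarily in lowest terms). An integer $a$ is represented in unary by its sign and a string of length $|a|$. For a matrix $\mathbf M\in\mathbb Q^{n\times m}$, a ranking function $r$ yields a permutation $r(\mathbf M)$ of $\{1,\dots,n\}$, where $r(\mathbf M)(i)$ is the position of row $i$. The ranking functions $r_{\mathsf{Max}}^{\mathsf{asc}}$ and $r_{\mathsf{Max}}^{\mathsf{dsc}}$ order the rows by increasing, respectively decreasing, maximum entry; $r_{\mathsf{Sum}}$ orders them by increasing sum of entries; $r_{\mathsf{Lex}}$ orders them by the left-to-right lexicographic order, ascending in every column. In all cases ties are broken in favour of the smaller row index. For a ranking function $r$, the *precedence problem* $\mathrm{PREC}\langle r\rangle$ is the following. The input is a matrix $\mathbf M$ with two rows and $m$ columns, and finite probability distributions $\Pi_1,\dots,\Pi_m$ over $\mathbb Q$, each given as a list of value-probability pairs. Let $\mathbf u=(u_1,\dots,u_m)$ with the weights $u_j\sim\Pi_j$ independent, and let $\mathbf M\circ\mathbf u$ be the matrix obtained from $\mathbf M$ by multiplying the $j$-th column by $u_j$ for every $j$.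 The task is to compute $$\mathbb P_{\mathbf u\sim\Pi_1\times\dots\times\Pi_m}\bigl[s(1)<s(2)\bigr],\qquad s=r(\mathbf M\circ\mathbf u),$$ the probability that the first row precedes the second. **Theorem.** The problems $\mathrm{PREC}\langle r_{\mathsf{Max}}^{\mathsf{asc}}\rangle$, $\mathrm{PREC}\langle r_{\mathsf{Max}}^{\mathsf{dsc}}\rangle$ and $\mathrm{PREC}\langle r_{\mathsf{Lex}}\rangle$ are solvable in polynomial time. The problem $\mathrm{PREC}\langle r_{\mathsf{Sum}}\rangle$ is solvable in polynomial time if the entries of $\mathbf M$ and the weights in the supports of the $\Pi_j$ are integers encoded in unary (the probabilities being still pairs of binary integers). -/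

import Mathlib

namespace Prec

/-! ### Ranking functions -/

/-- A ranking function maps every rational `n × m` matrix to a permutation of its row indices;
`r n m M i` is the position of row `i`, so row `i` precedes row `i'` iff
`r n m M i < r n m M i'`. -/
abbrev RankingFunction : Type :=
  (n m : ℕ) → Matrix (Fin n) (Fin m) ℚ → Equiv.Perm (Fin n)

/-- Positions of the rows when they are sorted by increasing `key`, ties being broken by the row
index. (`Tuple.sort key` sends a position to the row that occupies it.) -/
def rankByKey {α : Type} [LinearOrder α] {n : ℕ} (key : Fin n → α) : Equiv.Perm (Fin n) :=
  (Tuple.sort key)⁻¹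

/-- The `Max` score of a row; the maximum of a row without entries is `⊥`. -/
def scoreMax {m : ℕ} (a : Fin m → ℚ) : WithBot ℚ := (Finset.univ.image a).max

/-- The `Sum` score of a row. -/
def scoreSum {m : ℕ} (a : Fin m → ℚ) : ℚ := ∑ j, a j

/-- Ranking by increasing `Max`. -/
def rankMaxAsc : RankingFunction := fun _ _ M => rankByKey fun i => scoreMax (M i)

/-- Ranking by decreasing `Max` (ties are still broken by increasing row index). -/
def rankMaxDsc : RankingFunction := fun _ _ M =>
  rankByKey fun i => OrderDual.toDual (scoreMax (M i))

/-- Ranking by increasing `Sum`. -/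
def rankSum : RankingFunction := fun _ _ M => rankByKey fun i => scoreSum (M i)

/-- Ranking by the left-to-right lexicographic order on the rows, ascending in every column. -/
noncomputable def rankLex : RankingFunction := fun _ _ M => rankByKey fun i => toLex (M i)

/-! ### Representations of numbers -/

/-- The alphabet of the encodings. -/
inductive Symbol
  | bit (b : Bool)
  | slash
  | comma
  | semicolon
  deriving DecidableEq, Fintype

/-- A format in which numbers are written down. -/
class NumberFormat (V : Type) where
  /-- the rational number represented -/
  toRat : V → ℚ
  /-- the string that represents it -/
  encode : V → List Symbol

/-- Binary encoding of an integer: a sign bit, then the binary digits of the absolute value. -/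
def encodeBinaryInt (a : ℤ) : List Symbol :=
  Symbol.bit (decide (a < 0)) :: (Computability.encodeNat a.natAbs).map Symbol.bit

/-- Unary encoding of an integer: a sign bit, then `|a|` copies of the digit one. -/
def encodeUnaryInt (a : ℤ) : List Symbol :=
  Symbol.bit (decide (a < 0)) :: List.replicate a.natAbs (Symbol.bit true)

/-- A pair `(a, b)` of integers, `b ≠ 0`, not necessarily coprime, standing for `a / b`. -/
structure Fraction where
  num : ℤ
  den : ℤ
  den_ne_zero : den ≠ 0

/-- Fractions are written as numerator and denominator, both in binary. -/
instance : NumberFormat Fraction where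
  toRat q := (q.num : ℚ) / (q.den : ℚ)
  encode q := encodeBinaryInt q.num ++ Symbol.slash :: encodeBinaryInt q.den

/-- An integer that is to be written in unary. -/
structure UnaryInt where
  toInt : ℤ

instance : NumberFormat UnaryInt where
  toRat a := (a.toInt : ℚ)
  encode a := encodeUnaryInt a.toInt

/-! ### Distributions and inputs -/

/-- A finite probability distribution over `ℚ`, given as a list of value-probability pairs.
The values are in format `V`, the probabilities are binary fractions. -/
structure FiniteDist (V : Type) where
  pairs : List (V × Fraction)
  prob_nonneg : ∀ e ∈ pairs, 0 ≤ NumberFormat.toRat e.2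
  prob_sum : (pairs.map fun e => NumberFormat.toRat e.2).sum = 1

namespace FiniteDist

variable {V : Type} [NumberFormat V]

/-- The probability of the value `q` (if `q` is listed several times, the listed probabilities
add up). -/
def mass (d : FiniteDist V) (q : ℚ) : ℚ :=
  ((d.pairs.filter fun e => NumberFormat.toRat e.1 = q).map fun e => NumberFormat.toRat e.2).sum

/-- The finite set of listed values. -/
def values (d : FiniteDist V) : Finset ℚ :=
  (d.pairs.map fun e => NumberFormat.toRat e.1).toFinset

end FiniteDist

/-- An input of the precedence problem: a matrix with two rows and any number of columns, and one
weight distribution for each column. -/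
structure Input (V : Type) where
  cols : ℕ
  matrix : Matrix (Fin 2) (Fin cols) V
  dist : Fin cols → FiniteDist V

namespace Input

variable {V : Type} [NumberFormat V]

/-- The rational matrix of which the `j`-th column is multiplied by `u j`. -/
def weighted (x : Input V) (u : Fin x.cols → ℚ) : Matrix (Fin 2) (Fin x.cols) ℚ :=
  Matrix.of fun i j => NumberFormat.toRat (x.matrix i j) * u j

/-- The probability, over independent weights `u j` distributed according to `x.dist j`, that the
first row precedes the second one in the ranking of the weighted matrix. -/
def precProb (r : RankingFunction) (x : Input V) : ℚ :=
  ∑ u ∈ Fintype.piFinset fun j => (x.dist j).values,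
    if r 2 x.cols (x.weighted u) 0 < r 2 x.cols (x.weighted u) 1 then
      ∏ j, (x.dist j).mass (u j)
    else 0

/-- A column is written as its two matrix entries followed by the value-probability pairs of its
distribution, every number being closed by a comma and the column by a semicolon. -/
def encodeColumn (x : Input V) (j : Fin x.cols) : List Symbol :=
  NumberFormat.encode (x.matrix 0 j) ++ Symbol.comma ::
    (NumberFormat.encode (x.matrix 1 j) ++ Symbol.comma ::
      ((x.dist j).pairs.flatMap fun e =>
        NumberFormat.encode e.1 ++ Symbol.comma ::
          (NumberFormat.encode e.2 ++ [Symbol.comma])) ++ [Symbol.semicolon])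

/-- An input is written column by column. -/
def encode (x : Input V) : List Symbol :=
  (List.ofFn x.encodeColumn).flatten

end Input

/-- The problem of computing the number `value x` from the input `x` is solvable in polynomial
time: some Turing machine, on every input, outputs within a number of steps polynomial in the
length of the input string some fraction that represents `value x`. -/
def SolvableInPolyTime {I : Type} (encode : I → List Symbol) (value : I → ℚ) : Prop :=
  ∃ f : I → Fraction,
    (∀ x, NumberFormat.toRat (f x) = value x) ∧
      Nonempty (Turing.TM2ComputableInPolyTime encode
        (NumberFormat.encode : Fraction → List Symbol) f)

/-- The precedence problem for the ranking function `r`, with matrix entries and weights in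
format `V`, is solvable in polynomial time. -/
def PrecInPolyTime (V : Type) [NumberFormat V] (r : RankingFunction) : Prop :=
  SolvableInPolyTime (Input.encode : Input V → List Symbol) (Input.precProb r)

end Prec

/-!
Read the columns one after another and maintain the joint distribution of the scores of the two
rows. Multiplying the probabilities in every column by a common denominator turns it into a list of
states with integer weights, and one more column sends it to the list of all updated states with
multiplied weights, in which equal states are merged; the product of the common denominators is
divided out at the end. The weights stay short because their absolute values add up to at most the
product of the total weights of the columns.

It remains to see that few states occur. For `Max` a state is a pair of running maxima, both of
which are products of an entry and a weight from the input; for `Lex`, reading the columns from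
right to left, it is the column that decides the comparison. For `Sum` it is a pair of integers
bounded by the number of columns times the largest unary product.

Polynomial time is established on a class of functions between binary trees, in which all data are
coded: it contains the projections and pairings and is closed under composition, case distinctions
and recursions whose intermediate results are of polynomially bounded size. A structured program
that keeps its trees on a stack computes each of them and is compiled to a `TM2` machine.
-/

/-! ### Structured programs for stack machines -/

namespace Prec

open Function StateTransition

/-- Structured programs on stacks that are indexed by `K` and hold symbols from `Γ`. The tests `c`
of `ite` and `loop` see the topmost symbol of a stack, or `none` if the stack is empty. -/
inductive Prog (K Γ : Type)
  | push (k : K) (a : Γ)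
  | pop (k : K)
  | copyTop (k k' : K)
  | seq (p q : Prog K Γ)
  | ite (k : K) (c : Option Γ → Bool) (p q : Prog K Γ)
  | loop (k : K) (c : Option Γ → Bool) (p : Prog K Γ)

namespace Prog

variable {K Γ Λ : Type}

section Semantics

variable [DecidableEq K] [Inhabited Γ]

/-- The operational semantics: `Run p S S' t` says that `p`, started with stack contents `S`, ends
with `S'` after at most `t` steps. Copying the top of an empty stack pushes a default symbol. -/
inductive Run : Prog K Γ → (K → List Γ) → (K → List Γ) → ℕ → Prop
  | push (k a S) : Run (push k a) S (update S k (a :: S k)) 1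
  | pop (k S) : Run (pop k) S (update S k (S k).tail) 1
  | copyTop (k k' S) : Run (copyTop k k') S (update S k' ((S k).headI :: S k')) 1
  | seq {p q S S' S'' t t'} (hp : Run p S S' t) (hq : Run q S' S'' t') :
      Run (seq p q) S S'' (t + t')
  | iteTrue {k c p q S S' t} (hc : c (S k).head? = true) (hp : Run p S S' t) :
      Run (ite k c p q) S S' (t + 1)
  | iteFalse {k c p q S S' t} (hc : c (S k).head? = false) (hq : Run q S S' t) :
      Run (ite k c p q) S S' (t + 1)
  | loopFalse {k c p S} (hc : c (S k).head? = false) : Run (loop k c p) S S 1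
  | loopTrue {k c p S S' S'' t t'} (hc : c (S k).head? = true) (hp : Run p S S' t)
      (hl : Run (loop k c p) S' S'' t') : Run (loop k c p) S S'' (t + t' + 1)
  | mono {p S S' t t'} (hp : Run p S S' t) (ht : t ≤ t') : Run p S S' t'

theorem Run.of_eq {p : Prog K Γ} {S S' S'' : K → List Γ} {t t' : ℕ} (h : Run p S S' t)
    (hS : S' = S'') (ht : t ≤ t') : Run p S S'' t' :=
  hS ▸ h.mono ht

theorem Run.length_le {p : Prog K Γ} {S S' : K → List Γ} {t : ℕ} (h : Run p S S' t) (k : K) :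
    (S' k).length ≤ (S k).length + t := by
  induction h with
  | push k' _ S | copyTop _ k' S =>
    obtain rfl | hk := eq_or_ne k k'
    · simp
    · simp [update_of_ne hk]
  | pop k' S =>
    obtain rfl | hk := eq_or_ne k k'
    · simp only [update_self, List.length_tail]
      omega
    · simp [update_of_ne hk]
  | _ => omega

end Semantics

/-! ### Compilation -/

/-- Labels of the machine that executes a program: one for every atomic instruction and one for
every test. -/
def Label : Prog K Γ → Type
  | push _ _ | pop _ | copyTop _ _ => Unit
  | seq p q => Label p ⊕ Label q
  | ite _ _ p q => Option (Label p ⊕ Label q)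
  | loop _ _ p => Option (Label p)

/-- The label at which the execution of a program starts. -/
def entry : (p : Prog K Γ) → Label p
  | push _ _ | pop _ | copyTop _ _ => ()
  | seq p _ => .inl (entry p)
  | ite _ _ _ _ | loop _ _ _ => none

instance fintypeLabel : (p : Prog K Γ) → Fintype (Label p)
  | push _ _ | pop _ | copyTop _ _ => inferInstanceAs (Fintype Unit)
  | seq p q =>
    letI := fintypeLabel p
    letI := fintypeLabel q
    inferInstanceAs (Fintype (Label p ⊕ Label q))
  | ite _ _ p q =>
    letI := fintypeLabel p
    letI := fintypeLabel q
    inferInstanceAs (Fintype (Option (Label p ⊕ Label q)))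
  | loop _ _ p =>
    letI := fintypeLabel p
    inferInstanceAs (Fintype (Option (Label p)))

/-- Statements of the stack machines. Their internal state holds a symbol temporarily; it is `none`
between any two statements. -/
abbrev Stmt (K Γ Λ : Type) : Type := Turing.TM2.Stmt (fun _ : K => Γ) Λ (Option Γ)

/-- Reset the internal state and go to the given label, or halt if there is none. -/
def jump : Option Λ → Stmt K Γ Λ
  | some l => .load (fun _ => none) (.goto fun _ => l)
  | none => .load (fun _ => none) .halt

variable [DecidableEq K]

theorem stepAux_jump (x : Option Λ) (v : Option Γ) (S : K → List Γ) :
    Turing.TM2.stepAux (jump x) v S = ⟨x, none, S⟩ := by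
  cases x <;> rfl

variable [Inhabited Γ]

/-- The statement at each label of a program, if the labels are embedded into the labels of a
larger program by `e`, and the program is left to the label `x`. -/
def stmt : (p : Prog K Γ) → (Label p → Λ) → Option Λ → Label p → Stmt K Γ Λ
  | push k a, _, x, _ => .push k (fun _ => a) (jump x)
  | pop k, _, x, _ => .pop k (fun v _ => v) (jump x)
  | copyTop k k', _, x, _ => .peek k (fun _ a => a) (.push k' (·.getD default) (jump x))
  | seq p q, e, x, l =>
    match l with
    | .inl l => stmt p (fun l => e (.inl l)) (some (e (.inr q.entry))) l
    | .inr l => stmt q (fun l => e (.inr l)) x l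
  | ite k c p q, e, x, l =>
    match l with
    | none => .peek k (fun _ a => a) (.branch c (jump (some (e (some (.inl p.entry)))))
        (jump (some (e (some (.inr q.entry))))))
    | some (.inl l) => stmt p (fun l => e (some (.inl l))) x l
    | some (.inr l) => stmt q (fun l => e (some (.inr l))) x l
  | loop k c p, e, x, l =>
    match l with
    | none => .peek k (fun _ a => a) (.branch c (jump (some (e (some p.entry)))) (jump x))
    | some l => stmt p (fun l => e (some l)) (some (e none)) l

theorem Run.nonempty_evalsToInTime {p : Prog K Γ} {S S' : K → List Γ} {t : ℕ} (h : Run p S S' t)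
    (m : Λ → Stmt K Γ Λ) (e : Label p → Λ) (x : Option Λ) (hm : ∀ l, m (e l) = stmt p e x l) :
    Nonempty (EvalsToInTime (Turing.TM2.step m) ⟨some (e p.entry), none, S⟩
      (some ⟨x, none, S'⟩) t) := by
  have single {c c'} (h : Turing.TM2.step m c = some c') :
      EvalsToInTime (Turing.TM2.step m) c (some c') 1 := ⟨⟨1, h⟩, le_rfl⟩
  induction h generalizing x with
  | push | pop =>
    refine ⟨single ?_⟩
    rw [Turing.TM2.step, hm]
    simp [stmt, stepAux_jump]
  | copyTop k k' S =>
    refine ⟨single ?_⟩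
    rw [Turing.TM2.step, hm]
    cases h : S k <;> simp [stmt, stepAux_jump, h]
  | @seq p q S S' S'' t t' _ _ ihp ihq =>
    obtain ⟨hp⟩ := ihp (fun l => e (.inl l)) (some (e (.inr q.entry))) fun l => hm (.inl l)
    obtain ⟨hq⟩ := ihq (fun l => e (.inr l)) x fun l => hm (.inr l)
    rw [add_comm]
    exact ⟨hp.trans _ _ _ _ _ _ hq⟩
  | iteTrue hc _ ihp =>
    obtain ⟨hp⟩ := ihp (fun l => e (some (.inl l))) x fun l => hm (some (.inl l))
    refine ⟨(single ?_).trans _ _ _ _ _ _ hp⟩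
    rw [Turing.TM2.step, hm]
    simp [stmt, entry, stepAux_jump, hc]
  | iteFalse hc _ ihq =>
    obtain ⟨hq⟩ := ihq (fun l => e (some (.inr l))) x fun l => hm (some (.inr l))
    refine ⟨(single ?_).trans _ _ _ _ _ _ hq⟩
    rw [Turing.TM2.step, hm]
    simp [stmt, entry, stepAux_jump, hc]
  | loopFalse hc =>
    refine ⟨single ?_⟩
    rw [Turing.TM2.step, hm]
    simp [stmt, entry, stepAux_jump, hc]
  | @loopTrue k c p S S' S'' t t' hc _ _ ihp ihl =>
    obtain ⟨hp⟩ := ihp (fun l => e (some l)) (some (e none)) fun l => hm (some l)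
    obtain ⟨hl⟩ := ihl e x hm
    rw [add_comm t]
    refine ⟨(single ?_).trans _ _ _ _ _ _ (hp.trans _ _ _ _ _ _ hl)⟩
    rw [Turing.TM2.step, hm]
    simp [stmt, entry, stepAux_jump, hc]
  | mono _ ht ih =>
    obtain ⟨h⟩ := ih e x hm
    exact ⟨⟨h.toEvalsTo, h.steps_le_m.trans ht⟩⟩

section Machine

variable [Fintype K] [Fintype Γ]

/-- The stack machine that executes a program, with input stack `k₀` and output stack `k₁`. -/
def machine (p : Prog K Γ) (k₀ k₁ : K) : Turing.FinTM2 where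
  K := K
  k₀ := k₀
  k₁ := k₁
  Γ _ := Γ
  Λ := Label p
  main := p.entry
  ΛFin := fintypeLabel p
  σ := Option Γ
  initialState := none
  Γk₀Fin := inferInstanceAs (Fintype Γ)
  m := stmt p id none

theorem initList_machine (p : Prog K Γ) (k₀ k₁ : K) (l : List Γ) :
    Turing.initList (p.machine k₀ k₁) l =
      (⟨some p.entry, none, update (fun _ => []) k₀ l⟩ : (p.machine k₀ k₁).Cfg) := by
  unfold Turing.initList
  congr 1
  refine funext fun k : K => ?_
  by_cases hk : k = k₀
  · subst hk
    exact (dif_pos rfl).trans (update_self (β := fun _ => List Γ) k l fun _ => []).symm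
  · exact (dif_neg hk).trans (update_of_ne (β := fun _ => List Γ) hk l fun _ => []).symm

theorem haltList_machine (p : Prog K Γ) (k₀ k₁ : K) (l : List Γ) :
    Turing.haltList (p.machine k₀ k₁) l =
      (⟨none, none, update (fun _ => []) k₁ l⟩ : (p.machine k₀ k₁).Cfg) := by
  unfold Turing.haltList
  congr 1
  refine funext fun k : K => ?_
  by_cases hk : k = k₁
  · subst hk
    exact (dif_pos rfl).trans (update_self (β := fun _ => List Γ) k l fun _ => []).symm
  · exact (dif_neg hk).trans (update_of_ne (β := fun _ => List Γ) hk l fun _ => []).symm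

theorem Run.nonempty_tm2OutputsInTime {p : Prog K Γ} {k₀ k₁ : K} {l l' : List Γ} {t : ℕ}
    (h : Run p (update (fun _ => []) k₀ l) (update (fun _ => []) k₁ l') t) :
    Nonempty (Turing.TM2OutputsInTime (p.machine k₀ k₁) l (some l') t) := by
  have hl := initList_machine p k₀ k₁ l
  have hl' := haltList_machine p k₀ k₁ l'
  obtain ⟨⟨⟨steps, heval⟩, hsteps⟩⟩ :=
    h.nonempty_evalsToInTime (stmt p id none) id none fun _ => rfl
  exact ⟨⟨⟨steps, (congrArg _ (congrArg some hl)).trans (heval.trans (congrArg some hl').symm)⟩,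
    hsteps⟩⟩

end Machine

theorem nonempty_tm2ComputableInPolyTime [Finite K] [Finite Γ] {I O : Type} {ei : I → List Γ}
    {eo : O → List Γ} {f : I → O} (p : Prog K Γ) (k₀ k₁ : K) (P : Polynomial ℕ)
    (h : ∀ x, Run p (update (fun _ => []) k₀ (ei x)) (update (fun _ => []) k₁ (eo (f x)))
      (P.eval (ei x).length)) :
    Nonempty (Turing.TM2ComputableInPolyTime ei eo f) := by
  cases nonempty_fintype K
  cases nonempty_fintype Γ
  refine ⟨⟨⟨p.machine k₀ k₁, Equiv.refl Γ, Equiv.refl Γ⟩, P, fun x => Nonempty.some ?_⟩⟩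
  have hmap (l : List Γ) : l.map (Equiv.refl Γ).invFun = l := List.map_id l
  exact Run.nonempty_tm2OutputsInTime (p := p) ((hmap (ei x)).symm ▸ (hmap (eo (f x))).symm ▸ h x)

end Prog

end Prec

/-! ### Trees as data, and programs that act on the topmost tree of a stack -/

namespace Prec

open Function

instance : Inhabited Symbol := ⟨.slash⟩

/-- Binary trees with Boolean leaves, the universal data type of the programs below. -/
inductive Data
  | leaf (b : Bool)
  | node (x y : Data)

namespace Data

/-- The symbols of a tree in preorder, where a comma stands for a node. -/
def str : Data → List Symbol
  | leaf b => [.bit b]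
  | node x y => .comma :: (x.str ++ y.str)

/-- The left subtree of a node; a leaf is its own left subtree. -/
def left : Data → Data
  | leaf b => leaf b
  | node x _ => x

/-- The right subtree of a node; a leaf is its own right subtree. -/
def right : Data → Data
  | leaf b => leaf b
  | node _ y => y

def isNode : Data → Bool
  | leaf _ => false
  | node _ _ => true

end Data

/-- Types whose elements are represented by trees. -/
class Coded (α : Type) where
  /-- the tree that represents an element -/
  toData : α → Data

open Coded

instance : Coded Data := ⟨id⟩

instance : Coded Bool := ⟨Data.leaf⟩

instance {α β : Type} [Coded α] [Coded β] : Coded (α × β) :=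
  ⟨fun p => .node (toData p.1) (toData p.2)⟩

/-- Lists are represented by right combs. -/
instance {α : Type} [Coded α] : Coded (List α) :=
  ⟨List.foldr (fun a d => .node (toData a) d) (.leaf false)⟩

section Size

variable {α β : Type} [Coded α] [Coded β]

/-- The string that represents an element. -/
def str (a : α) : List Symbol := (toData a).str

/-- The length of the string that represents an element. -/
def size (a : α) : ℕ := (str a).length

theorem length_str (a : α) : (str a).length = size a := rfl

theorem str_mk (a : α) (b : β) : str (a, b) = .comma :: (str a ++ str b) := rfl

theorem str_cons (a : α) (l : List α) : str (a :: l) = .comma :: (str a ++ str l) := rfl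

@[simp] theorem size_bool (b : Bool) : size b = 1 := rfl

@[simp] theorem size_prod (p : α × β) : size p = size p.1 + size p.2 + 1 := by
  rw [← length_str, str_mk p.1 p.2, List.length_cons, List.length_append, length_str, length_str]

@[simp] theorem size_nil : size ([] : List α) = 1 := rfl

@[simp] theorem size_cons (a : α) (l : List α) : size (a :: l) = size a + size l + 1 := by
  rw [← length_str, str_cons, List.length_cons, List.length_append, length_str, length_str]

theorem length_lt_size (l : List α) : l.length < size l := by
  induction l with
  | nil => simp
  | cons a l ih =>
    rw [List.length_cons, size_cons]
    omega

end Size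

/-- The stacks of our machines. Data are kept on `main`; the input arrives on `aux`, and the output
is left on `buffer`. -/
inductive Stack
  | main
  | aux
  | buffer
  | counter
  deriving DecidableEq

instance : Fintype Stack where
  elems := {.main, .aux, .buffer, .counter}
  complete k := by cases k <;> decide

/-- The assignment of the given contents to the four stacks. -/
def store (m a b c : List Symbol) : Stack → List Symbol
  | .main => m
  | .aux => a
  | .buffer => b
  | .counter => c

section Store

variable (m a b c l : List Symbol)

@[simp] theorem store_main : store m a b c .main = m := rfl

@[simp] theorem store_aux : store m a b c .aux = a := rfl

@[simp] theorem store_buffer : store m a b c .buffer = b := rfl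

@[simp] theorem store_counter : store m a b c .counter = c := rfl

@[simp] theorem update_store_main : update (store m a b c) .main l = store l a b c := by
  funext k
  cases k <;> rfl

@[simp] theorem update_store_aux : update (store m a b c) .aux l = store m l b c := by
  funext k
  cases k <;> rfl

@[simp] theorem update_store_buffer : update (store m a b c) .buffer l = store m a l c := by
  funext k
  cases k <;> rfl

@[simp] theorem update_store_counter : update (store m a b c) .counter l = store m a b l := by
  funext k
  cases k <;> rfl

end Store

namespace Prog

section

variable {m a b c : List Symbol} {s : Symbol}

theorem run_push_main : Run (push .main s) (store m a b c) (store (s :: m) a b c) 1 :=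
  (Run.push _ _ _).of_eq (by simp) le_rfl

theorem run_push_aux : Run (push .aux s) (store m a b c) (store m (s :: a) b c) 1 :=
  (Run.push _ _ _).of_eq (by simp) le_rfl

theorem run_push_counter : Run (push .counter s) (store m a b c) (store m a b (s :: c)) 1 :=
  (Run.push _ _ _).of_eq (by simp) le_rfl

theorem run_pop_main : Run (pop .main) (store (s :: m) a b c) (store m a b c) 1 :=
  (Run.pop _ _).of_eq (by simp) le_rfl

theorem run_pop_aux : Run (pop .aux) (store m (s :: a) b c) (store m a b c) 1 :=
  (Run.pop _ _).of_eq (by simp) le_rfl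

theorem run_pop_buffer : Run (pop .buffer) (store m a (s :: b) c) (store m a b c) 1 :=
  (Run.pop _ _).of_eq (by simp) le_rfl

theorem run_pop_counter : Run (pop .counter) (store m a b (s :: c)) (store m a b c) 1 :=
  (Run.pop _ _).of_eq (by simp) le_rfl

end

/-- Move everything from the stack `k` to the stack `k'`. -/
def transfer (k k' : Stack) : Prog Stack Symbol :=
  loop k Option.isSome (seq (copyTop k k') (pop k))

theorem run_transfer {k k' : Stack} (hk : k ≠ k') (S : Stack → List Symbol) :
    Run (transfer k k') S (update (update S k' ((S k).reverse ++ S k')) k [])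
      (3 * (S k).length + 1) := by
  generalize hl : S k = l
  induction l generalizing S with
  | nil =>
    refine (Run.loopFalse (by simp [hl])).of_eq ?_ (by simp)
    simp [hl]
  | cons s l ih =>
    refine (Run.loopTrue (by simp [hl]) ((Run.copyTop k k' S).seq (Run.pop k _))
      (ih _ (by simp [hl, hk]))).of_eq ?_ (by simp; omega)
    rw [update_of_ne hk.symm, update_self, update_comm hk, update_idem, update_idem]
    simp [hl]

theorem run_transfer_aux_main (m a b c : List Symbol) :
    Run (transfer .aux .main) (store m a b c) (store (a.reverse ++ m) [] b c)
      (3 * a.length + 1) :=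
  (run_transfer (by decide) _).of_eq (by simp) le_rfl

theorem run_transfer_aux_buffer (m a b c : List Symbol) :
    Run (transfer .aux .buffer) (store m a b c) (store m [] (a.reverse ++ b) c)
      (3 * a.length + 1) :=
  (run_transfer (by decide) _).of_eq (by simp) le_rfl

theorem run_transfer_buffer_aux (m a b c : List Symbol) :
    Run (transfer .buffer .aux) (store m a b c) (store m (b.reverse ++ a) [] c)
      (3 * b.length + 1) :=
  (run_transfer (by decide) _).of_eq (by simp) le_rfl

/-- Move symbols from `main` to `aux` until the number of subtrees still to be read, which is the
height of the stack `counter`, is zero. -/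
def scan : Prog Stack Symbol :=
  loop .counter Option.isSome
    (seq (ite .main (· = some .comma) (push .counter .comma) (pop .counter))
      (seq (copyTop .main .aux) (pop .main)))

theorem run_scan (d : Data) {m a b c : List Symbol} {S : Stack → List Symbol} {t : ℕ}
    (s : Symbol) (h : Run scan (store m (d.str.reverse ++ a) b c) S t) :
    Run scan (store (d.str ++ m) a b (s :: c)) S (t + 5 * d.str.length) := by
  have move {s m a c} : Run (seq (copyTop .main .aux) (pop .main)) (store (s :: m) a b c)
      (store m (s :: a) b c) 2 :=
    ((Run.copyTop _ _ _).seq (Run.pop _ _)).of_eq (by simp) le_rfl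
  induction d generalizing m a c s t with
  | leaf x =>
    refine (Run.loopTrue rfl ((Run.iteFalse ?_ run_pop_counter).seq move) h).mono ?_
    · simp
    · simp only [Data.str, List.length_singleton]
      omega
  | node x y ihx ihy =>
    have hxy : Run scan (store (x.str ++ (y.str ++ m)) (.comma :: a) b (.comma :: s :: c)) S
        (t + 5 * y.str.length + 5 * x.str.length) :=
      ihx .comma (ihy s (by simpa [Data.str] using h))
    rw [Data.str, List.cons_append, List.append_assoc]
    refine (Run.loopTrue rfl ((Run.iteTrue ?_ run_push_counter).seq move) hxy).mono ?_
    · simp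
    · simp only [List.length_cons, List.length_append]
      omega

/-- Move a tree from `main` to `aux`. -/
def take : Prog Stack Symbol := seq (push .counter .comma) scan

theorem run_take (d : Data) (m a b : List Symbol) :
    Run take (store (d.str ++ m) a b []) (store m (d.str.reverse ++ a) b [])
      (5 * d.str.length + 2) :=
  (run_push_counter.seq (run_scan d .comma (Run.loopFalse rfl))).mono (by omega)

/-- Remove everything from the stack `aux`. -/
def clear : Prog Stack Symbol := loop .aux Option.isSome (pop .aux)

theorem run_clear (m a b c : List Symbol) :
    Run clear (store m a b c) (store m [] b c) (2 * a.length + 1) := by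
  induction a with
  | nil => exact Run.loopFalse rfl
  | cons s a ih => exact (Run.loopTrue rfl run_pop_aux ih).mono (by simp; omega)

/-- Remove a tree from `main`. -/
def drop : Prog Stack Symbol := seq take clear

theorem run_drop (d : Data) (m b : List Symbol) :
    Run drop (store (d.str ++ m) [] b []) (store m [] b []) (7 * d.str.length + 3) :=
  ((run_take _ _ _ _).seq (run_clear _ _ _ _)).mono (by simp; omega)

/-- Exchange the two topmost trees of `main`. -/
def swap : Prog Stack Symbol :=
  seq take (seq (transfer .aux .buffer)
    (seq take (seq (transfer .buffer .aux) (transfer .aux .main))))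

theorem run_swap (d e : Data) (m : List Symbol) :
    Run swap (store (d.str ++ (e.str ++ m)) [] [] []) (store (e.str ++ (d.str ++ m)) [] [] [])
      (14 * (d.str.length + e.str.length) + 8) :=
  ((run_take _ _ _ _).seq ((run_transfer_aux_buffer _ _ _ _).seq ((run_take _ _ _ _).seq
    ((run_transfer_buffer_aux _ _ _ _).seq (run_transfer_aux_main _ _ _ _))))).of_eq
      (by simp) (by simp; omega)

/-- Move everything from `aux` to `main`, and a copy to `buffer`. -/
def spread : Prog Stack Symbol :=
  loop .aux Option.isSome (seq (copyTop .aux .buffer) (seq (copyTop .aux .main) (pop .aux)))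

theorem run_spread (m a b c : List Symbol) :
    Run spread (store m a b c) (store (a.reverse ++ m) [] (a.reverse ++ b) c)
      (4 * a.length + 1) := by
  induction a generalizing m b with
  | nil => exact Run.loopFalse rfl
  | cons s a ih =>
    refine (Run.loopTrue rfl (((Run.copyTop _ _ _).seq ((Run.copyTop _ _ _).seq
      (Run.pop _ _))).of_eq ?_ le_rfl) (ih (s :: m) (s :: b))).of_eq (by simp) (by simp; omega)
    simp

/-- Duplicate the topmost tree of `main`. -/
def dup : Prog Stack Symbol :=
  seq take (seq spread (seq (transfer .buffer .aux) (transfer .aux .main)))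

theorem run_dup (d : Data) (m : List Symbol) :
    Run dup (store (d.str ++ m) [] [] []) (store (d.str ++ (d.str ++ m)) [] [] [])
      (15 * d.str.length + 5) :=
  ((run_take _ _ _ _).seq ((run_spread _ _ _ _).seq ((run_transfer_buffer_aux _ _ _ _).seq
    (run_transfer_aux_main _ _ _ _)))).of_eq (by simp) (by simp; omega)

/-- Push a string onto `main`, and go on with a program. -/
def pushStr : List Symbol → Prog Stack Symbol → Prog Stack Symbol
  | [], p => p
  | s :: l, p => pushStr l (seq (push .main s) p)

theorem run_pushStr (l : List Symbol) {m a b c : List Symbol} {p : Prog Stack Symbol}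
    {S : Stack → List Symbol} {t : ℕ} (h : Run p (store (l ++ m) a b c) S t) :
    Run (pushStr l p) (store m a b c) S (t + l.length) := by
  induction l generalizing p t with
  | nil => exact h
  | cons s l ih => exact (ih (run_push_main.seq h)).mono (by simp; omega)

/-- Do nothing. -/
def skip : Prog Stack Symbol := seq (push .main .slash) (pop .main)

theorem run_skip (m a b c : List Symbol) : Run skip (store m a b c) (store m a b c) 2 :=
  run_push_main.seq run_pop_main

end Prog

end Prec

/-! ### Polynomial-time functions on coded data -/

namespace Prec

open Function Coded Prog

theorem polynomial_eval_mono (P : Polynomial ℕ) : Monotone P.eval := fun m n h => by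
  simp only [Polynomial.eval_eq_sum_range]
  gcongr

section

variable {α β γ : Type} [Coded α] [Coded β] [Coded γ]

/-- Quantities that are bounded by a polynomial in the size of their argument. -/
@[fun_prop]
def PolyBounded (t : α → ℕ) : Prop := ∃ P : Polynomial ℕ, ∀ a, t a ≤ P.eval (size a)

/-- Functions that some program computes in polynomial time on the topmost tree of `main`. -/
@[fun_prop]
def PolyTime (f : α → β) : Prop :=
  ∃ (p : Prog Stack Symbol) (P : Polynomial ℕ), ∀ a m,
    Run p (store (str a ++ m) [] [] []) (store (str (f a) ++ m) [] [] []) (P.eval (size a))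

theorem PolyTime.polyBounded_size {f : α → β} (hf : PolyTime f) :
    PolyBounded fun a => size (f a) := by
  obtain ⟨p, P, h⟩ := hf
  refine ⟨.X + P, fun a => ?_⟩
  simpa [length_str] using (h a []).length_le .main

namespace PolyBounded

theorem mono {s t : α → ℕ} (ht : PolyBounded t) (h : ∀ a, s a ≤ t a) : PolyBounded s :=
  ht.imp fun _ hP a => (h a).trans (hP a)

@[fun_prop]
theorem const (k : ℕ) : PolyBounded fun _ : α => k := ⟨.C k, fun _ => by simp⟩

@[fun_prop]
theorem size_self : PolyBounded fun a : α => size a := ⟨.X, fun _ => by simp⟩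

@[fun_prop]
theorem add {s t : α → ℕ} (hs : PolyBounded s) (ht : PolyBounded t) :
    PolyBounded fun a => s a + t a := by
  obtain ⟨P, hP⟩ := hs
  obtain ⟨Q, hQ⟩ := ht
  exact ⟨P + Q, fun a => by simpa using add_le_add (hP a) (hQ a)⟩

@[fun_prop]
theorem mul {s t : α → ℕ} (hs : PolyBounded s) (ht : PolyBounded t) :
    PolyBounded fun a => s a * t a := by
  obtain ⟨P, hP⟩ := hs
  obtain ⟨Q, hQ⟩ := ht
  exact ⟨P * Q, fun a => by simpa using Nat.mul_le_mul (hP a) (hQ a)⟩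

@[fun_prop]
theorem eval {t : α → ℕ} (ht : PolyBounded t) (P : Polynomial ℕ) :
    PolyBounded fun a => P.eval (t a) := by
  obtain ⟨Q, hQ⟩ := ht
  exact ⟨P.comp Q, fun a => by
    simpa [Polynomial.eval_comp] using polynomial_eval_mono P (hQ a)⟩

@[fun_prop]
theorem size {f : α → β} (hf : PolyTime f) : PolyBounded fun a => size (f a) :=
  hf.polyBounded_size

end PolyBounded

namespace PolyTime

theorem of_run {f : α → β} {t : α → ℕ} (p : Prog Stack Symbol) (ht : PolyBounded t)
    (h : ∀ a m, Run p (store (str a ++ m) [] [] []) (store (str (f a) ++ m) [] [] []) (t a)) :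
    PolyTime f := by
  obtain ⟨P, hP⟩ := ht
  exact ⟨p, P, fun a m => (h a m).mono (hP a)⟩

theorem of_toData_eq {f : α → β} {g : α → γ} (hf : PolyTime f)
    (h : ∀ a, toData (g a) = toData (f a)) : PolyTime g := by
  have hstr (a : α) : str (g a) = str (f a) := congrArg Data.str (h a)
  simpa only [PolyTime, hstr] using hf

@[fun_prop]
theorem id : PolyTime fun a : α => a :=
  of_run skip (PolyBounded.const 2) fun _ _ => run_skip _ _ _ _

@[fun_prop]
theorem comp {g : β → γ} (hg : PolyTime g) {f : α → β} (hf : PolyTime f) :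
    PolyTime fun a => g (f a) := by
  have ⟨p, P, hp⟩ := hf
  have ⟨q, Q, hq⟩ := hg
  exact of_run (seq p q) (by fun_prop) fun a m => (hp a m).seq (hq _ m)

@[fun_prop]
theorem const (b : β) : PolyTime fun _ : α => b :=
  of_run (t := fun a => 7 * size a + 3 + (2 + size b)) (seq drop (pushStr (str b) skip))
    (by fun_prop) fun a m => (run_drop (toData a) m []).seq (run_pushStr _ (run_skip _ _ _ _))

@[fun_prop]
theorem prodMk {f : α → β} {g : α → γ} (hf : PolyTime f) (hg : PolyTime g) :
    PolyTime fun a => (f a, g a) := by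
  have ⟨p, P, hp⟩ := hf
  have ⟨q, Q, hq⟩ := hg
  refine of_run (t := fun a => (15 * size a + 5) + (Q.eval (size a) +
    ((14 * (size (g a) + size a) + 8) + (P.eval (size a) + 1))))
    (seq dup (seq q (seq swap (seq p (push .main .comma))))) (by fun_prop) fun a m => ?_
  refine ((run_dup (toData a) m).seq ((hq a _).seq ((run_swap (toData (g a)) (toData a) m).seq
    ((hp a _).seq run_push_main)))).of_eq ?_ le_rfl
  rw [str_mk, List.cons_append, List.append_assoc]
  rfl

@[fun_prop]
theorem prod_fst : PolyTime fun p : α × β => p.1 := by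
  refine of_run (t := fun p => 14 * size p + (7 * size p + 12)) (seq (pop .main) (seq swap drop))
    (by fun_prop) fun p m => ?_
  rw [str_mk p.1 p.2, List.cons_append, List.append_assoc]
  refine (run_pop_main.seq ((run_swap (toData p.1) (toData p.2) m).seq
    (run_drop (toData p.2) _ []))).mono ?_
  change 1 + (14 * (size p.1 + size p.2) + 8 + (7 * size p.2 + 3)) ≤ _
  rw [size_prod]
  omega

@[fun_prop]
theorem prod_snd : PolyTime fun p : α × β => p.2 := by
  refine of_run (t := fun p => 7 * size p + 4) (seq (pop .main) drop) (by fun_prop) fun p m => ?_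
  rw [str_mk p.1 p.2, List.cons_append, List.append_assoc]
  refine (run_pop_main.seq (run_drop (toData p.1) _ [])).mono ?_
  change 1 + (7 * size p.1 + 3) ≤ _
  rw [size_prod]
  omega

@[fun_prop]
theorem fst {f : α → β × γ} (hf : PolyTime f) : PolyTime fun a => (f a).1 := prod_fst.comp hf

@[fun_prop]
theorem snd {f : α → β × γ} (hf : PolyTime f) : PolyTime fun a => (f a).2 := prod_snd.comp hf

@[fun_prop]
theorem cond {c : α → Bool} {f g : α → β} (hc : PolyTime c) (hf : PolyTime f) (hg : PolyTime g) :
    PolyTime fun a => bif c a then f a else g a := by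
  obtain ⟨p, P, hp⟩ := hf
  obtain ⟨q, Q, hq⟩ := hg
  obtain ⟨r, R, hr⟩ := hc
  refine of_run (t := fun a => (15 * size a + 5) + (R.eval (size a) +
      ((1 + (P.eval (size a) + Q.eval (size a))) + 1)))
    (seq dup (seq r (ite .main (· = some (.bit true)) (seq (pop .main) p) (seq (pop .main) q))))
    (by fun_prop) fun a m => ?_
  refine (run_dup (toData a) m).seq ((hr a _).seq ?_)
  cases c a with
  | false => exact (run_pop_main.seq ((hq a m).mono (Nat.le_add_left _ _))).iteFalse rfl
  | true => exact (run_pop_main.seq ((hp a m).mono (Nat.le_add_right _ _))).iteTrue rfl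

@[fun_prop]
theorem isNode : PolyTime Data.isNode := by
  refine of_run (t := fun d => 7 * size d + 3 + 1 + 1)
    (ite .main (· = some .comma) (seq drop (push .main (.bit true)))
      (seq drop (push .main (.bit false)))) (by fun_prop) fun d m => ?_
  cases d with
  | leaf b => exact ((run_drop _ m []).seq run_push_main).iteFalse rfl
  | node x y => exact ((run_drop _ m []).seq run_push_main).iteTrue rfl

@[fun_prop]
theorem left : PolyTime Data.left := by
  refine of_run (t := fun d => 30 * size d + 30)
    (ite .main (· = some .comma) (seq (pop .main) (seq swap drop)) skip) (by fun_prop)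
    fun d m => ?_
  cases d with
  | leaf b => exact ((run_skip _ _ _ _).iteFalse rfl).mono (by omega)
  | node x y =>
    change Run _ (store (.comma :: (x.str ++ y.str) ++ m) _ _ _) _ _
    rw [List.cons_append, List.append_assoc]
    refine ((run_pop_main.seq ((run_swap x y m).seq (run_drop y _ []))).iteTrue rfl).mono ?_
    simp only [size, str, toData, id_eq, Data.str, List.length_cons, List.length_append]
    omega

@[fun_prop]
theorem right : PolyTime Data.right := by
  refine of_run (t := fun d => 7 * size d + 5)
    (ite .main (· = some .comma) (seq (pop .main) drop) skip) (by fun_prop) fun d m => ?_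
  cases d with
  | leaf b => exact ((run_skip _ _ _ _).iteFalse rfl).mono (by omega)
  | node x y =>
    change Run _ (store (.comma :: (x.str ++ y.str) ++ m) _ _ _) _ _
    rw [List.cons_append, List.append_assoc]
    refine ((run_pop_main.seq (run_drop x _ [])).iteTrue rfl).mono ?_
    simp only [size, str, toData, id_eq, Data.str, List.length_cons, List.length_append]
    omega

section Iterate

variable {c : β → Bool} {f : β → β}

theorem run_iterate {q r : Prog Stack Symbol} {Q R : Polynomial ℕ}
    (hq : ∀ b m, Run q (store (str b ++ m) [] [] []) (store (str (f b) ++ m) [] [] [])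
      (Q.eval (size b)))
    (hr : ∀ b m, Run r (store (str b ++ m) [] [] []) (store (str (c b) ++ m) [] [] [])
      (R.eval (size b)))
    {B N : ℕ} (m : List Symbol) {b : β} (htrue : ∀ i < N, c (f^[i] b) = true)
    (hfalse : c (f^[N] b) = false) (hsize : ∀ i ≤ N, size (f^[i] b) ≤ B) :
    Run (loop .main (· = some (.bit true)) (seq (pop .main) (seq q (seq dup r))))
      (store (str (c b) ++ (str b ++ m)) [] [] [])
      (store (str (c (f^[N] b)) ++ (str (f^[N] b) ++ m)) [] [] [])
      (N * (Q.eval B + (15 * B + 7) + R.eval B) + 1) := by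
  induction N generalizing b with
  | zero => exact (Run.loopFalse (by rw [show c b = false from hfalse]; rfl)).mono (by omega)
  | succ N ih =>
    have hc : c b = true := htrue 0 (Nat.succ_pos _)
    have hB : Q.eval (size b) ≤ Q.eval B :=
      polynomial_eval_mono Q (hsize 0 (Nat.zero_le _))
    have hfB : size (f b) ≤ B := hsize 1 (by omega)
    have hRB : R.eval (size (f b)) ≤ R.eval B := polynomial_eval_mono R hfB
    refine (Run.loopTrue (by rw [hc]; rfl) (run_pop_main.seq ((hq b m).seq
      ((run_dup (toData (f b)) m).seq (hr (f b) _))))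
      (ih (fun i hi => htrue (i + 1) (by omega)) hfalse
        fun i hi => hsize (i + 1) (by omega))).mono ?_
    change 1 + (_ + (15 * size (f b) + 5 + _)) + _ + 1 ≤ _
    rw [add_mul, one_mul]
    omega

theorem iterate {s : α → β} (hs : PolyTime s) (hc : PolyTime c) (hf : PolyTime f) {N B : α → ℕ}
    (hB : PolyBounded B) (hN : ∀ a, N a ≤ B a) (htrue : ∀ a, ∀ i < N a, c (f^[i] (s a)) = true)
    (hfalse : ∀ a, c (f^[N a] (s a)) = false) (hsize : ∀ a, ∀ i ≤ N a, size (f^[i] (s a)) ≤ B a) :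
    PolyTime fun a => f^[N a] (s a) := by
  have ⟨p, P, hp⟩ := hs
  have ⟨q, Q, hq⟩ := hf
  have ⟨r, R, hr⟩ := hc
  refine of_run (t := fun a => P.eval (size a) + ((15 * size (s a) + 5) + (R.eval (size (s a)) +
      ((B a * (Q.eval (B a) + (15 * B a + 7) + R.eval (B a)) + 1) + 1))))
    (seq p (seq dup (seq r (seq (loop .main (· = some (.bit true))
      (seq (pop .main) (seq q (seq dup r)))) (pop .main))))) (by fun_prop) fun a m => ?_
  refine (hp a m).seq ((run_dup (toData (s a)) m).seq ((hr _ _).seq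
    (((run_iterate hq hr m (htrue a) (hfalse a) (hsize a)).mono ?_).seq run_pop_main)))
  gcongr
  exact hN a

end Iterate

end PolyTime

end

end Prec

/-! ### Input and output -/

namespace Prec

open Function Coded Prog

def Symbol.toData : Symbol → Data
  | bit b => .leaf b
  | slash => .node (.leaf false) (.leaf false)
  | comma => .node (.leaf false) (.leaf true)
  | semicolon => .node (.leaf true) (.leaf false)

instance : Coded Symbol := ⟨Symbol.toData⟩

theorem size_symbol_le (s : Symbol) : size s ≤ 3 := by
  cases s <;> simp [size, str, toData, Symbol.toData, Data.str]

theorem size_symbols_le (l : List Symbol) : size l ≤ 4 * l.length + 1 := by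
  induction l with
  | nil => simp
  | cons s l ih =>
    have := size_symbol_le s
    rw [size_cons, List.length_cons]
    omega

namespace Prog

/-- Move the topmost symbol of `buffer`, known to be `s`, to the list on top of `main`. -/
def loadSymbol (s : Symbol) : Prog Stack Symbol := pushStr (.comma :: str s) (pop .buffer)

theorem run_loadSymbol (s : Symbol) (m b : List Symbol) :
    Run (loadSymbol s) (store m [] (s :: b) []) (store (.comma :: (str s ++ m)) [] b []) 5 := by
  refine (run_pushStr (.comma :: str s) run_pop_buffer).mono ?_
  have := size_symbol_le s
  rw [List.length_cons, length_str]
  omega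

/-- Move the topmost symbol of `buffer` to the list on top of `main`. -/
def loadTop : Prog Stack Symbol :=
  ite .buffer (· = some (.bit false)) (loadSymbol (.bit false))
    (ite .buffer (· = some (.bit true)) (loadSymbol (.bit true))
      (ite .buffer (· = some .slash) (loadSymbol .slash)
        (ite .buffer (· = some .comma) (loadSymbol .comma) (loadSymbol .semicolon))))

theorem run_loadTop (s : Symbol) (m b : List Symbol) :
    Run loadTop (store m [] (s :: b) []) (store (.comma :: (str s ++ m)) [] b []) 9 := by
  have h := run_loadSymbol s m b
  rcases s with ⟨_ | _⟩ | _ | _ | _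
  · exact (h.iteTrue rfl).mono (by omega)
  · exact ((h.iteTrue rfl).iteFalse rfl).mono (by omega)
  · exact (((h.iteTrue rfl).iteFalse rfl).iteFalse rfl).mono (by omega)
  · exact (((h.iteTrue rfl).iteFalse rfl).iteFalse rfl).iteFalse rfl
  · exact (((h.iteFalse rfl).iteFalse rfl).iteFalse rfl).iteFalse rfl

/-- Replace the string on `aux` by the list of its symbols on `main`. -/
def load : Prog Stack Symbol :=
  seq (transfer .aux .buffer) (seq (push .main (.bit false)) (loop .buffer Option.isSome loadTop))

theorem run_loop_loadTop (l k : List Symbol) :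
    Run (loop .buffer Option.isSome loadTop) (store (str k) [] l [])
      (store (str (l.reverse ++ k)) [] [] []) (10 * l.length + 1) := by
  induction l generalizing k with
  | nil => exact Run.loopFalse rfl
  | cons s l ih =>
    rw [List.reverse_cons, List.append_assoc]
    refine (Run.loopTrue rfl (run_loadTop s _ l) (ih (s :: k))).mono ?_
    rw [List.length_cons]
    omega

theorem run_load (l : List Symbol) :
    Run load (store [] l [] []) (store (str l) [] [] []) (13 * l.length + 3) := by
  have hloop := run_loop_loadTop (l.reverse ++ []) []
  refine ((run_transfer_aux_buffer _ _ _ _).seq (run_push_main.seq hloop)).of_eq (by simp) ?_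
  simp only [List.append_nil, List.length_reverse]
  omega

/-- Move the symbol that is represented on top of `main` to `aux`. -/
def unloadTop : Prog Stack Symbol :=
  ite .main (· = some .comma)
    (seq (pop .main) (ite .main (· = some (.bit false))
      (seq (pop .main) (ite .main (· = some (.bit false))
        (seq (pop .main) (push .aux .slash)) (seq (pop .main) (push .aux .comma))))
      (seq (pop .main) (seq (pop .main) (push .aux .semicolon)))))
    (seq (copyTop .main .aux) (pop .main))

theorem run_unloadTop (s : Symbol) (m a : List Symbol) :
    Run unloadTop (store (str s ++ m) a [] []) (store m (s :: a) [] []) 7 := by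
  have hpush (s : Symbol) {s' m a} :
      Run (seq (pop .main) (push .aux s)) (store (s' :: m) a [] []) (store m (s :: a) [] []) 2 :=
    run_pop_main.seq run_push_aux
  cases s with
  | bit b =>
    exact (((Run.copyTop _ _ _).seq (Run.pop _ _)).iteFalse rfl).of_eq
      (by simp [str, toData, Symbol.toData, Data.str]) (by omega)
  | slash =>
    exact ((run_pop_main.seq ((run_pop_main.seq ((hpush _).iteTrue rfl)).iteTrue rfl)).iteTrue
      rfl).mono (by omega)
  | comma =>
    exact ((run_pop_main.seq ((run_pop_main.seq ((hpush _).iteFalse rfl)).iteTrue rfl)).iteTrue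
      rfl).mono (by omega)
  | semicolon =>
    exact ((run_pop_main.seq ((run_pop_main.seq (hpush _)).iteFalse rfl)).iteTrue
      rfl).mono (by omega)

/-- Replace the list of symbols on `main` by a string on `buffer`. -/
def unload : Prog Stack Symbol :=
  seq (loop .main (· = some .comma) (seq (pop .main) unloadTop))
    (seq (pop .main) (transfer .aux .buffer))

theorem run_loop_unloadTop (l a : List Symbol) :
    Run (loop .main (· = some .comma) (seq (pop .main) unloadTop)) (store (str l) a [] [])
      (store [.bit false] (l.reverse ++ a) [] []) (9 * l.length + 1) := by
  induction l generalizing a with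
  | nil => exact Run.loopFalse rfl
  | cons s l ih =>
    rw [List.reverse_cons, List.append_assoc]
    refine (Run.loopTrue rfl (run_pop_main.seq (run_unloadTop s (str l) a))
      (ih (s :: a))).mono ?_
    rw [List.length_cons]
    omega

theorem run_unload (l : List Symbol) :
    Run unload (store (str l) [] [] []) (store [] [] l []) (12 * l.length + 3) :=
  ((run_loop_unloadTop l []).seq (run_pop_main.seq (run_transfer_aux_buffer _ _ _ _))).of_eq
    (by simp) (by simp; omega)

end Prog

theorem PolyTime.nonempty_tm2ComputableInPolyTime {I O : Type} {ei : I → List Symbol}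
    {eo : O → List Symbol} {g : I → O} {f : List Symbol → List Symbol} (hf : PolyTime f)
    (h : ∀ x, f (ei x) = eo (g x)) : Nonempty (Turing.TM2ComputableInPolyTime ei eo g) := by
  obtain ⟨Q, hQ⟩ := hf.polyBounded_size
  obtain ⟨p, P, hp⟩ := hf
  refine Prog.nonempty_tm2ComputableInPolyTime (seq load (seq p unload)) .aux .buffer
    (13 * .X + 3 + (P.comp (4 * .X + 1) + (12 * Q.comp (4 * .X + 1) + 3))) fun x => ?_
  have hstart : update (fun _ => []) Stack.aux (ei x) = store [] (ei x) [] [] := by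
    funext k
    cases k <;> rfl
  have hend : update (fun _ => []) Stack.buffer (eo (g x)) = store [] [] (eo (g x)) [] := by
    funext k
    cases k <;> rfl
  have hrun := hp (ei x) []
  rw [List.append_nil, List.append_nil] at hrun
  have hlen : (f (ei x)).length ≤ Q.eval (size (ei x)) := (length_lt_size _).le.trans (hQ _)
  rw [hstart, hend, ← h]
  refine ((run_load (ei x)).seq (hrun.seq (run_unload _))).mono ?_
  have hsize := size_symbols_le (ei x)
  have hP := polynomial_eval_mono P hsize
  have hQ' := polynomial_eval_mono Q hsize
  simp only [Polynomial.eval_add, Polynomial.eval_mul, Polynomial.eval_comp, Polynomial.eval_X,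
    Polynomial.eval_ofNat, Polynomial.eval_one] at hP hQ' ⊢
  omega

end Prec

/-! ### Lists -/

namespace Prec

open Function Coded

section

variable {α β γ : Type} [Coded α] [Coded β] [Coded γ]

theorem size_lt_of_mem {l : List α} {a : α} (h : a ∈ l) : size a < size l := by
  induction l with
  | nil => simp at h
  | cons b l ih =>
    rw [size_cons]
    rcases List.mem_cons.1 h with rfl | h
    · omega
    · have := ih h
      omega

theorem size_list_le {l : List α} {k : ℕ} (h : ∀ a ∈ l, size a ≤ k) :
    size l ≤ l.length * (k + 1) + 1 := by
  induction l with
  | nil => simp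
  | cons a l ih =>
    have hl := ih fun b hb => h b (List.mem_cons_of_mem _ hb)
    have ha := h a List.mem_cons_self
    rw [size_cons, List.length_cons, add_mul]
    omega

theorem size_append_add_one (l k : List α) : size (l ++ k) + 1 = size l + size k := by
  induction l with
  | nil => simp [add_comm]
  | cons a l ih =>
    rw [List.cons_append, size_cons, size_cons]
    omega

theorem size_append_le (l k : List α) : size (l ++ k) ≤ size l + size k :=
  (Nat.le_succ _).trans (size_append_add_one l k).le

theorem size_take_le (l : List α) (k : ℕ) : size (l.take k) ≤ size l := by
  have h := size_append_add_one (l.take k) (l.drop k)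
  have := length_lt_size (l.drop k)
  rw [List.take_append_drop] at h
  omega

theorem size_drop_le (l : List α) (k : ℕ) : size (l.drop k) ≤ size l := by
  have h := size_append_add_one (l.take k) (l.drop k)
  have := length_lt_size (l.take k)
  rw [List.take_append_drop] at h
  omega

theorem size_reverse (l : List α) : size l.reverse = size l := by
  induction l with
  | nil => rfl
  | cons a l ih =>
    have := size_append_add_one l.reverse [a]
    rw [List.reverse_cons, size_cons]
    simp only [size_cons, size_nil] at this
    omega

theorem size_flatten_le (l : List (List α)) : size l.flatten ≤ size l := by
  induction l with
  | nil => exact le_rfl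
  | cons a l ih =>
    have := size_append_le a l.flatten
    rw [List.flatten_cons, size_cons]
    omega

namespace PolyTime

@[fun_prop]
theorem not {f : α → Bool} (hf : PolyTime f) : PolyTime fun a => !f a :=
  (hf.cond (const false) (const true)).of_toData_eq fun a => by cases f a <;> rfl

@[fun_prop]
theorem and {f g : α → Bool} (hf : PolyTime f) (hg : PolyTime g) :
    PolyTime fun a => f a && g a :=
  (hf.cond hg (const false)).of_toData_eq fun a => by cases f a <;> rfl

@[fun_prop]
theorem or {f g : α → Bool} (hf : PolyTime f) (hg : PolyTime g) :
    PolyTime fun a => f a || g a :=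
  (hf.cond (const true) hg).of_toData_eq fun a => by cases f a <;> rfl

@[fun_prop]
theorem xor {f g : α → Bool} (hf : PolyTime f) (hg : PolyTime g) :
    PolyTime fun a => f a ^^ g a :=
  (hf.cond hg.not hg).of_toData_eq fun a => by cases f a <;> cases g a <;> rfl

@[fun_prop]
theorem toData : PolyTime (toData : α → Data) := id.of_toData_eq fun _ => rfl

@[fun_prop]
theorem cons {f : α → β} {l : α → List β} (hf : PolyTime f) (hl : PolyTime l) :
    PolyTime fun a => f a :: l a :=
  (hf.prodMk hl).of_toData_eq fun _ => rfl

@[fun_prop]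
theorem isEmpty {l : α → List β} (hl : PolyTime l) : PolyTime fun a => (l a).isEmpty :=
  (isNode.comp (toData.comp hl)).not.of_toData_eq fun a => by cases l a <;> rfl

@[fun_prop]
theorem tail {l : α → List β} (hl : PolyTime l) : PolyTime fun a => (l a).tail :=
  (right.comp (toData.comp hl)).of_toData_eq fun a => by cases l a <;> rfl

@[fun_prop]
theorem headI [Inhabited β] {l : α → List β} (hl : PolyTime l) :
    PolyTime fun a => (l a).headI := by
  have h : PolyTime fun a => bif (l a).isEmpty then Coded.toData (default : β)
      else (Coded.toData (l a)).left := by fun_prop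
  exact h.of_toData_eq fun a => by cases l a <;> rfl

theorem foldl {l : γ → List α} {i : γ → β} {f : γ → β → α → β} (hl : PolyTime l)
    (hi : PolyTime i) (hf : PolyTime fun p : γ × β × α => f p.1 p.2.1 p.2.2) {B : γ → ℕ}
    (hB : PolyBounded B) (h : ∀ x k, size (((l x).take k).foldl (f x) (i x)) ≤ B x) :
    PolyTime fun x => (l x).foldl (f x) (i x) := by
  rcases isEmpty_or_nonempty α with hα | ⟨⟨a₀⟩⟩
  · have hnil (x : γ) : l x = [] := List.eq_nil_iff_forall_not_mem.2 fun a => isEmptyElim a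
    simpa only [hnil, List.foldl_nil] using hi
  have : Inhabited α := ⟨a₀⟩
  let step : γ × List α × β → γ × List α × β :=
    fun p => (p.1, p.2.1.tail, f p.1 p.2.2 p.2.1.headI)
  have hstep : PolyTime step := by
    have : PolyTime fun p : γ × List α × β => f p.1 p.2.2 p.2.1.headI :=
      hf.comp (f := fun p : γ × List α × β => (p.1, p.2.2, p.2.1.headI)) (by fun_prop)
    fun_prop
  have hiter (x : γ) (k : ℕ) (hk : k ≤ (l x).length) : step^[k] (x, l x, i x) =
      (x, (l x).drop k, ((l x).take k).foldl (f x) (i x)) := by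
    induction k with
    | zero => rfl
    | succ k ih =>
      rw [iterate_succ_apply', ih (by omega), List.drop_eq_getElem_cons hk,
        ← List.take_concat_get' _ _ hk, List.foldl_append]
      rfl
  have hloop : PolyTime fun x => step^[(l x).length] (x, l x, i x) := by
    refine iterate (c := fun p => !p.2.1.isEmpty) (B := fun x => size x + size (l x) + B x + 2)
      (by fun_prop) (by fun_prop) hstep (by fun_prop) ?_ ?_ ?_ ?_
    · intro x
      have := length_lt_size (l x)
      omega
    · intro x k hk
      simpa [hiter x k hk.le] using hk
    · intro x
      simp [hiter]
    · intro x k hk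
      have := size_drop_le (l x) k
      have := h x k
      simp only [hiter x k hk, size_prod]
      omega
  have := hloop.snd.snd
  simpa only [hiter _ _ le_rfl, List.take_length] using this

@[fun_prop]
theorem reverse {l : γ → List α} (hl : PolyTime l) : PolyTime fun x => (l x).reverse := by
  have h (l : List α) : l.foldl (fun r a => a :: r) [] = l.reverse := by simp
  simp only [← h]
  refine foldl (B := fun x => size (l x)) hl (by fun_prop) (by fun_prop) (by fun_prop) ?_
  intro x k
  rw [h, size_reverse]
  exact size_take_le _ _

theorem foldr {l : γ → List α} {i : γ → β} {f : γ → α → β → β} (hl : PolyTime l)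
    (hi : PolyTime i) (hf : PolyTime fun p : γ × α × β => f p.1 p.2.1 p.2.2) {B : γ → ℕ}
    (hB : PolyBounded B) (h : ∀ x k, size (((l x).drop k).foldr (f x) (i x)) ≤ B x) :
    PolyTime fun x => (l x).foldr (f x) (i x) := by
  have hfoldr (x : γ) : (l x).foldr (f x) (i x) =
      (l x).reverse.foldl (fun r a => f x a r) (i x) := (List.foldl_reverse ..).symm
  simp only [hfoldr]
  refine foldl hl.reverse hi ?_ hB ?_
  · exact hf.comp (f := fun p : γ × β × α => (p.1, p.2.2, p.2.1)) (by fun_prop)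
  · intro x k
    rw [List.take_reverse, List.foldl_reverse]
    exact h x _

@[fun_prop]
theorem append {l k : γ → List α} (hl : PolyTime l) (hk : PolyTime k) :
    PolyTime fun x => l x ++ k x := by
  have h (l k : List α) : l.foldr List.cons k = l ++ k := by simp
  simp only [← h]
  refine foldr (B := fun x => size (l x) + size (k x)) hl hk (by fun_prop) (by fun_prop) ?_
  intro x j
  rw [h]
  exact (size_append_le _ _).trans (Nat.add_le_add_right (size_drop_le _ _) _)

@[fun_prop]
theorem map {l : γ → List α} {f : γ → α → β} (hl : PolyTime l)
    (hf : PolyTime fun p : γ × α => f p.1 p.2) : PolyTime fun x => (l x).map (f x) := by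
  obtain ⟨P, hP⟩ := hf.polyBounded_size
  simp only [List.map_eq_foldr]
  refine foldr (B := fun x => size (l x) * (P.eval (size x + size (l x) + 1) + 1) + 1) hl
    (by fun_prop) ?_ (by fun_prop) ?_
  · exact (hf.comp (f := fun p : γ × α × List β => (p.1, p.2.1)) (by fun_prop)).cons
      (by fun_prop)
  · intro x k
    rw [← List.map_eq_foldr]
    refine (size_list_le (k := P.eval (size x + size (l x) + 1)) ?_).trans ?_
    · intro b hb
      obtain ⟨a, ha, rfl⟩ := List.mem_map.1 hb
      refine (hP (x, a)).trans (polynomial_eval_mono P ?_)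
      have := size_lt_of_mem (List.mem_of_mem_drop ha)
      simp only [size_prod]
      omega
    · gcongr
      rw [List.length_map]
      exact (length_lt_size _).le.trans (size_drop_le _ _)

@[fun_prop]
theorem flatten {l : γ → List (List α)} (hl : PolyTime l) : PolyTime fun x => (l x).flatten := by
  have h (l : List (List α)) : l.foldr (fun a r => a ++ r) [] = l.flatten := by
    induction l <;> simp_all
  simp only [← h]
  refine foldr (B := fun x => size (l x)) hl (by fun_prop) (by fun_prop) (by fun_prop) ?_
  intro x k
  rw [h]
  exact (size_flatten_le _).trans (size_drop_le _ _)

@[fun_prop]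
theorem flatMap {l : γ → List α} {f : γ → α → List β} (hl : PolyTime l)
    (hf : PolyTime fun p : γ × α => f p.1 p.2) : PolyTime fun x => (l x).flatMap (f x) := by
  simp only [List.flatMap_def]
  fun_prop

end PolyTime

end

/-! ### Linear recursion -/

section LinearRec

variable {α β : Type} {c : α → Bool} {n : α → α}

theorem exists_first_iterate {μ : α → ℕ} (hμ : ∀ x, c x = false → μ (n x) < μ x) (x : α) :
    ∃ k ≤ μ x, c (n^[k] x) = true ∧ ∀ i < k, c (n^[i] x) = false := by
  induction hm : μ x using Nat.strong_induction_on generalizing x with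
  | _ m ih =>
    cases hc : c x with
    | true => exact ⟨0, Nat.zero_le _, hc, fun i hi => absurd hi (Nat.not_lt_zero i)⟩
    | false =>
      obtain ⟨k, hk, hck, hlt⟩ := ih _ (hm ▸ hμ x hc) (n x) rfl
      refine ⟨k + 1, by have := hμ x hc; omega, hck, fun i hi => ?_⟩
      cases i with
      | zero => exact hc
      | succ i => exact hlt i (by omega)

theorem foldr_list_iterate {f g : α → β} {h : α → β → β}
    (hf : ∀ x, f x = bif c x then g x else h x (f (n x))) {k : ℕ} {x : α}
    (hc : ∀ i < k, c (n^[i] x) = false) :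
    (List.iterate n x k).foldr h (f (n^[k] x)) = f x := by
  induction k generalizing x with
  | zero => rfl
  | succ k ih =>
    rw [List.iterate, List.foldr_cons, iterate_succ_apply,
      ih fun i hi => hc (i + 1) (by omega), hf x, show c x = false from hc 0 k.succ_pos, cond_false]

theorem drop_list_iterate (n : α → α) (x : α) (k j : ℕ) :
    (List.iterate n x k).drop j = List.iterate n (n^[j] x) (k - j) := by
  induction j generalizing x k with
  | zero => rfl
  | succ j ih =>
    cases k with
    | zero => simp [List.iterate]
    | succ k => simpa [List.iterate] using ih (n x) k

variable [Coded α] [Coded β]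

theorem size_iterate_le (hn : ∀ x, size (n x) ≤ size x) (x : α) (k : ℕ) :
    size (n^[k] x) ≤ size x := by
  induction k with
  | zero => exact le_rfl
  | succ k ih =>
    rw [iterate_succ_apply']
    exact (hn _).trans ih

namespace PolyTime

theorem iterates (hc : PolyTime c) (hn : PolyTime n) (hsize : ∀ x, size (n x) ≤ size x)
    {N : α → ℕ} (hN : PolyBounded N) (htrue : ∀ x, c (n^[N x] x) = true)
    (hfalse : ∀ x, ∀ i < N x, c (n^[i] x) = false) :
    PolyTime fun x => (n^[N x] x, List.iterate n x (N x)) := by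
  have hiter (x : α) (k : ℕ) : (fun p : α × List α => (n p.1, p.1 :: p.2))^[k] (x, []) =
      (n^[k] x, (List.iterate n x k).reverse) := by
    induction k with
    | zero => rfl
    | succ k ih =>
      rw [iterate_succ_apply', ih, iterate_succ_apply', List.iterate_add n x k 1]
      simp [List.iterate]
  have hloop : PolyTime fun x => (fun p : α × List α => (n p.1, p.1 :: p.2))^[N x] (x, []) := by
    refine iterate (c := fun p => !c p.1) (B := fun x => N x * (size x + 1) + size x + N x + 2)
      (by fun_prop) (by fun_prop) (by fun_prop) (by fun_prop) ?_ ?_ ?_ ?_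
    · intro x
      omega
    · intro x i hi
      simp [hiter, hfalse x i hi]
    · intro x
      simp [hiter, htrue]
    · intro x i hi
      have hx := size_iterate_le hsize x i
      have hl : size (List.iterate n x i) ≤ i * (size x + 1) + 1 := by
        refine (size_list_le (k := size x) fun a ha => ?_).trans (by simp)
        obtain ⟨j, -, rfl⟩ := List.mem_iterate.1 ha
        exact size_iterate_le hsize x j
      have : i * (size x + 1) ≤ N x * (size x + 1) := by gcongr
      simp only [hiter, size_prod, size_reverse]
      omega
  simp only [hiter] at hloop
  exact (hloop.fst.prodMk hloop.snd.reverse).of_toData_eq fun x => by simp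

theorem linearRec {f g : α → β} {h : α → β → β} (hc : PolyTime c) (hn : PolyTime n)
    (hg : PolyTime g) (hh : PolyTime fun p : α × β => h p.1 p.2)
    (hf : ∀ x, f x = bif c x then g x else h x (f (n x))) {μ : α → ℕ}
    (hμ : ∀ x, c x = false → μ (n x) < μ x) (hμB : PolyBounded μ)
    (hsize : ∀ x, size (n x) ≤ size x) (hfB : PolyBounded fun x => size (f x)) :
    PolyTime f := by
  choose N hNμ htrue hfalse using exists_first_iterate hμ
  have hiter := iterates hc hn hsize (hμB.mono hNμ) htrue hfalse
  have ⟨P, hP⟩ := hfB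
  have hbase (x : α) : g (n^[N x] x) = f (n^[N x] x) := by rw [hf, htrue, cond_true]
  have hdrop (x : α) (k : ℕ) : ((List.iterate n x (N x)).drop k).foldr h (g (n^[N x] x)) =
      f (n^[min k (N x)] x) := by
    have hsplit : n^[N x] x = n^[N x - min k (N x)] (n^[min k (N x)] x) := by
      rw [← iterate_add_apply, Nat.sub_add_cancel (min_le_right _ _)]
    rw [hbase, hsplit, List.drop_eq_drop_min, List.length_iterate, drop_list_iterate]
    refine foldr_list_iterate hf fun i hi => ?_
    rw [← iterate_add_apply]
    exact hfalse x _ (by omega)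
  refine (foldr (f := fun _ => h) (B := fun x => P.eval (size x)) hiter.snd (hg.comp hiter.fst)
    (hh.comp prod_snd) (by fun_prop) fun x k => ?_).of_toData_eq fun x => ?_
  · rw [hdrop]
    exact (hP _).trans (polynomial_eval_mono P (size_iterate_le hsize x _))
  · exact congrArg _ (hdrop x 0).symm

end PolyTime

end LinearRec

end Prec

/-! ### Arithmetic -/

namespace Prec

open Function Coded Computability

section Nat

instance : Coded ℕ := ⟨fun n => toData (encodeNat n)⟩

theorem encodeNat_bit {b : Bool} {n : ℕ} (h : Nat.bit b n ≠ 0) :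
    encodeNat (Nat.bit b n) = b :: encodeNat n := by
  unfold encodeNat
  rw [← Num.ofNat'_eq, ← Num.ofNat'_eq, Num.ofNat'_bit]
  rcases hn : Num.ofNat' n with _ | p
  · obtain rfl : n = 0 := by simpa [Num.ofNat'_eq] using congrArg (fun m : Num => (m : ℕ)) hn
    cases b
    · simp at h
    · rfl
  · cases b <;> rfl

theorem toData_bit {b : Bool} {n : ℕ} (h : Nat.bit b n ≠ 0) :
    toData (Nat.bit b n) = .node (.leaf b) (toData n) := by
  change toData (encodeNat (Nat.bit b n)) = _
  rw [encodeNat_bit h]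
  rfl

theorem size_bit {b : Bool} {n : ℕ} (h : Nat.bit b n ≠ 0) :
    size (Nat.bit b n) = size n + 2 := by
  have : size (Nat.bit b n) = size (b, n) := by rw [size, str, toData_bit h]; rfl
  simp only [this, size_prod, size_bool]
  omega

theorem size_nat (n : ℕ) : size n = 2 * n.size + 1 := by
  induction n using Nat.binaryRec' with
  | zero => rfl
  | bit b n _ ih =>
    by_cases h0 : Nat.bit b n = 0
    · rw [h0]
      rfl
    · rw [Nat.size_bit h0, size_bit h0, ih]
      rfl

theorem size_nat_mono {m n : ℕ} (h : m ≤ n) : size m ≤ size n := by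
  have := Nat.size_le_size h
  rw [size_nat, size_nat]
  omega

theorem size_nat_add_le (m n : ℕ) : size (m + n) ≤ size m + size n := by
  have : (m + n).size ≤ m.size + n.size := by
    rw [Nat.size_le, pow_add]
    have hm := Nat.lt_size_self m
    have hn := Nat.lt_size_self n
    nlinarith
  simp only [size_nat]
  omega

theorem size_nat_mul_le (m n : ℕ) : size (m * n) ≤ size m + size n := by
  have : (m * n).size ≤ m.size + n.size := by
    rw [Nat.size_le, pow_add]
    exact Nat.mul_lt_mul'' (Nat.lt_size_self m) (Nat.lt_size_self n)
  simp only [size_nat]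
  omega

theorem size_div2_le (n : ℕ) : n.div2.size ≤ n.size :=
  Nat.size_le_size (by rw [Nat.div2_val]; omega)

theorem size_div2_lt {n : ℕ} (h : n ≠ 0) : n.div2.size < n.size := by
  induction n using Nat.bitCasesOn with
  | bit b n => rw [Nat.size_bit h, Nat.div2_bit]; exact Nat.lt_succ_self _

namespace PolyTime

variable {α : Type} [Coded α]

@[fun_prop]
theorem bodd {f : α → ℕ} (hf : PolyTime f) : PolyTime fun a => (f a).bodd := by
  refine (left.comp (toData.comp hf)).of_toData_eq fun a => ?_
  induction f a using Nat.bitCasesOn with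
  | bit b n =>
    by_cases h : Nat.bit b n = 0
    · rw [h]
      rfl
    · rw [toData_bit h, Nat.bodd_bit]
      rfl

@[fun_prop]
theorem div2 {f : α → ℕ} (hf : PolyTime f) : PolyTime fun a => (f a).div2 := by
  refine (right.comp (toData.comp hf)).of_toData_eq fun a => ?_
  induction f a using Nat.bitCasesOn with
  | bit b n =>
    by_cases h : Nat.bit b n = 0
    · rw [h]
      rfl
    · rw [toData_bit h, Nat.div2_bit]
      rfl

@[fun_prop]
theorem nat_eq_zero {f : α → ℕ} (hf : PolyTime f) : PolyTime fun a => decide (f a = 0) := by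
  refine (isNode.comp (toData.comp hf)).not.of_toData_eq fun a => ?_
  induction f a using Nat.bitCasesOn with
  | bit b n =>
    by_cases h : Nat.bit b n = 0
    · rw [h]
      rfl
    · rw [toData_bit h, decide_eq_false h]
      rfl

@[fun_prop]
theorem bit {b : α → Bool} {f : α → ℕ} (hb : PolyTime b) (hf : PolyTime f) :
    PolyTime fun a => Nat.bit (b a) (f a) := by
  have h : PolyTime fun a => bif !b a && decide (f a = 0) then Coded.toData (0 : ℕ)
      else Coded.toData (b a, f a) := by fun_prop
  refine h.of_toData_eq fun a => ?_
  rcases eq_or_ne (Nat.bit (b a) (f a)) 0 with h0 | h0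
  · obtain ⟨hf0, hb0⟩ := Nat.bit_eq_zero_iff.1 h0
    rw [h0, hf0, hb0]
    rfl
  · have : (!b a && decide (f a = 0)) = false := by
      cases hb : b a <;> simp_all
    rw [toData_bit h0, this]
    rfl

theorem carryRec {β : Type} [Coded β] {f : ℕ × ℕ × Bool → β} {next : Bool → Bool → Bool → Bool}
    {g : Bool → β} {h : ℕ × ℕ × Bool → β → β}
    (hnext : PolyTime fun x : ℕ × ℕ × Bool => next x.1.bodd x.2.1.bodd x.2.2) (hg : PolyTime g)
    (hh : PolyTime fun p : (ℕ × ℕ × Bool) × β => h p.1 p.2) (hzero : ∀ c, f (0, 0, c) = g c)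
    (hdigit : ∀ a b c, (a = 0 → b ≠ 0) →
      f (a, b, c) = h (a, b, c) (f (a.div2, b.div2, next a.bodd b.bodd c)))
    (hfB : PolyBounded fun x => size (f x)) : PolyTime f := by
  refine linearRec (c := fun x : ℕ × ℕ × Bool => decide (x.1 = 0) && decide (x.2.1 = 0))
    (n := fun x => (x.1.div2, x.2.1.div2, next x.1.bodd x.2.1.bodd x.2.2)) (g := fun x => g x.2.2)
    (μ := fun x => x.1.size + x.2.1.size) (by fun_prop)
    (.prodMk (by fun_prop) (.prodMk (by fun_prop) hnext))
    (hg.comp (f := fun x : ℕ × ℕ × Bool => x.2.2) (by fun_prop)) hh (fun ⟨a, b, c⟩ => ?_)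
    (fun ⟨a, b, c⟩ hab => ?_) ?_ (fun ⟨a, b, c⟩ => ?_) hfB
  · by_cases hab : a = 0 ∧ b = 0
    · obtain ⟨rfl, rfl⟩ := hab
      exact hzero c
    · have : (decide (a = 0) && decide (b = 0)) = false := by simpa using hab
      simpa only [this, cond_false] using hdigit a b c (not_and.1 hab)
  · have ha := size_div2_le a
    have hb := size_div2_le b
    have hab : ¬(a = 0 ∧ b = 0) := by simpa using hab
    rcases not_and_or.1 hab with h | h <;> have := size_div2_lt h <;> dsimp only <;> omega
  · refine PolyBounded.size_self.mono fun x => ?_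
    simp only [size_prod, size_nat]
    omega
  · have ha := size_div2_le a
    have hb := size_div2_le b
    simp only [size_prod, size_nat, size_bool]
    omega

theorem nat_addCarry : PolyTime fun x : ℕ × ℕ × Bool => x.1 + x.2.1 + x.2.2.toNat := by
  refine carryRec (next := fun a b c => bif a then b || c else b && c)
    (g := fun c => bif c then 1 else 0)
    (h := fun x r => Nat.bit (x.1.bodd ^^ x.2.1.bodd ^^ x.2.2) r)
    (by fun_prop) (by fun_prop) (by fun_prop) (by decide) ?_ ?_
  · intro a b c _
    have ha := a.bodd_add_div2
    have hb := b.bodd_add_div2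
    simp only [Nat.bit_val]
    generalize a.bodd = a' at *
    generalize b.bodd = b' at *
    cases a' <;> cases b' <;> cases c <;> simp at ha hb ⊢ <;> omega
  · refine (PolyBounded.size_self.add (.const 3)).mono fun ⟨a, b, c⟩ => ?_
    have h₁ := size_nat_add_le (a + b) c.toNat
    have h₂ := size_nat_add_le a b
    have h₃ : size c.toNat ≤ 3 := by cases c <;> simp [size_nat]
    simp only [size_prod]
    omega

@[fun_prop]
theorem nat_add {f g : α → ℕ} (hf : PolyTime f) (hg : PolyTime g) : PolyTime fun a => f a + g a :=
  nat_addCarry.comp (f := fun a => (f a, g a, false)) (by fun_prop)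

theorem nat_leCarry :
    PolyTime fun x : ℕ × ℕ × Bool => decide (x.1 + x.2.2.toNat ≤ x.2.1) := by
  refine carryRec (next := fun a b c => bif b then a && c else a || c) (g := fun c => !c)
    (h := fun _ r => r) (by fun_prop) (by fun_prop) (by fun_prop) (by decide) ?_
    ((PolyBounded.const 1).mono fun _ => by simp)
  intro a b c _
  have ha := a.bodd_add_div2
  have hb := b.bodd_add_div2
  rw [decide_eq_decide]
  generalize a.bodd = a' at *
  generalize b.bodd = b' at *
  cases a' <;> cases b' <;> cases c <;> simp at ha hb ⊢ <;> omega

@[fun_prop]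
theorem nat_decide_le {f g : α → ℕ} (hf : PolyTime f) (hg : PolyTime g) :
    PolyTime fun a => decide (f a ≤ g a) :=
  nat_leCarry.comp (f := fun a => (f a, g a, false)) (by fun_prop)

theorem nat_subBorrow :
    PolyTime fun x : ℕ × ℕ × Bool => x.1 - (x.2.1 + x.2.2.toNat) := by
  have hle : PolyTime fun x : ℕ × ℕ × Bool => decide (x.2.1 + x.2.2.toNat ≤ x.1) :=
    nat_leCarry.comp (f := fun x : ℕ × ℕ × Bool => (x.2.1, x.1, x.2.2)) (by fun_prop)
  have hle' : PolyTime fun p : (ℕ × ℕ × Bool) × ℕ =>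
      decide (p.1.2.1 + p.1.2.2.toNat ≤ p.1.1) := hle.comp prod_fst
  refine carryRec (next := fun a b c => bif a then b && c else b || c) (g := fun _ => 0)
    (h := fun x r => bif decide (x.2.1 + x.2.2.toNat ≤ x.1)
      then Nat.bit (x.1.bodd ^^ x.2.1.bodd ^^ x.2.2) r else 0)
    (by fun_prop) (by fun_prop) (by fun_prop) (fun c => by simp) ?_ ?_
  · intro a b c _
    by_cases h : b + c.toNat ≤ a
    · have ha := a.bodd_add_div2
      have hb := b.bodd_add_div2
      simp only [h, decide_true, cond_true, Nat.bit_val]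
      generalize a.bodd = a' at *
      generalize b.bodd = b' at *
      cases a' <;> cases b' <;> cases c <;> simp at h ha hb ⊢ <;> omega
    · simp only [h, decide_false, cond_false]
      omega
  · refine PolyBounded.size_self.mono fun ⟨a, b, c⟩ => ?_
    have : size (a - (b + c.toNat)) ≤ size a := size_nat_mono (Nat.sub_le _ _)
    simp only [size_prod]
    omega

@[fun_prop]
theorem nat_sub {f g : α → ℕ} (hf : PolyTime f) (hg : PolyTime g) : PolyTime fun a => f a - g a :=
  nat_subBorrow.comp (f := fun a => (f a, g a, false)) (by fun_prop)

@[fun_prop]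
theorem nat_mul {f g : α → ℕ} (hf : PolyTime f) (hg : PolyTime g) :
    PolyTime fun a => f a * g a := by
  suffices h : PolyTime fun x : ℕ × ℕ => x.1 * x.2 from h.comp (hf.prodMk hg)
  refine linearRec (c := fun x => decide (x.1 = 0)) (n := fun x => (x.1.div2, x.2))
    (g := fun _ => 0) (h := fun x r => Nat.bit false r + bif x.1.bodd then x.2 else 0)
    (μ := fun x => x.1.size) (by fun_prop) (by fun_prop) (by fun_prop) (by fun_prop) ?_ ?_ ?_ ?_ ?_
  · rintro ⟨a, b⟩
    by_cases h : a = 0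
    · simp [h]
    · simp only [h, decide_false, cond_false, Nat.bit_val]
      conv_lhs => rw [← a.bodd_add_div2]
      cases a.bodd <;> simp <;> ring
  · rintro ⟨a, b⟩ h
    exact size_div2_lt (by simpa using h)
  · refine PolyBounded.size_self.mono fun x => ?_
    simp only [size_prod, size_nat]
    omega
  · rintro ⟨a, b⟩
    have := size_div2_le a
    simp only [size_prod, size_nat]
    omega
  · refine PolyBounded.size_self.mono fun ⟨a, b⟩ => ?_
    have := size_nat_mul_le a b
    simp only [size_prod]
    omega

end PolyTime

end Nat

end Prec

/-! ### Integers, options, and more functions on lists -/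

namespace Prec

open Function Coded

/-- An integer is represented by its positive part and its negative part. -/
instance : Coded ℤ := ⟨fun z => toData (z.toNat, (-z).toNat)⟩

theorem size_int (z : ℤ) : size z = 2 * z.natAbs.size + 3 := by
  have h : size z = size (z.toNat, (-z).toNat) := rfl
  have h0 : size (0 : ℕ) = 1 := rfl
  rcases le_total 0 z with hz | hz
  · have h₁ : z.toNat = z.natAbs := by omega
    have h₂ : (-z).toNat = 0 := by omega
    simp only [h, size_prod, h₁, h₂, h0, size_nat z.natAbs]
  · have h₁ : z.toNat = 0 := by omega
    have h₂ : (-z).toNat = z.natAbs := by omega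
    simp only [h, size_prod, h₁, h₂, h0, size_nat z.natAbs]
    omega

theorem size_int_eq_size_natAbs (z : ℤ) : size z = size z.natAbs + 2 := by
  rw [size_int, size_nat]

theorem size_int_add_le (a b : ℤ) : size (a + b) ≤ size a + size b := by
  have := (size_nat_mono (Int.natAbs_add_le a b)).trans (size_nat_add_le _ _)
  simp only [size_int_eq_size_natAbs]
  omega

theorem size_int_mul_le (a b : ℤ) : size (a * b) ≤ size a + size b := by
  have := size_nat_mul_le a.natAbs b.natAbs
  rw [← Int.natAbs_mul] at this
  simp only [size_int_eq_size_natAbs]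
  omega

instance {α : Type} [Coded α] : Coded (Option α) := ⟨fun o => toData o.toList⟩

/-- Types on which equality is decidable in polynomial time. -/
class PolyTimeEq (α : Type) [Coded α] [DecidableEq α] : Prop where
  decide_eq_prod : PolyTime fun p : α × α => decide (p.1 = p.2)

theorem size_le_of_sublist {α : Type} [Coded α] {l k : List α} (h : l.Sublist k) :
    size l ≤ size k := by
  induction h with
  | slnil => exact le_rfl
  | cons a _ ih =>
    rw [size_cons]
    omega
  | cons_cons a _ ih =>
    rw [size_cons, size_cons]
    omega

theorem size_pos {α : Type} [Coded α] (a : α) : 0 < size a := by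
  have h : 0 < (toData a).str.length := by cases toData a <;> simp [Data.str]
  exact h

theorem size_splitOnP_le {α : Type} [Coded α] (p : α → Bool) (l : List α) :
    size (l.splitOnP p) ≤ size l + 2 := by
  induction l with
  | nil => simp
  | cons a l ih =>
    obtain ⟨b, r, hr⟩ := List.exists_cons_of_ne_nil (List.splitOnP_ne_nil p l)
    rw [hr] at ih
    have := size_pos a
    rw [List.splitOnP_cons_eq_if_modifyHead, hr, size_cons a]
    cases p a <;> simp only [size_cons, size_nil, Bool.false_eq_true, if_true, if_false,
      List.modifyHead_cons] at ih ⊢ <;> omega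

theorem size_sum_le (l : List ℤ) : size l.sum ≤ size l + 2 := by
  induction l with
  | nil => simp [size_int]
  | cons a l ih =>
    have := size_int_add_le a l.sum
    rw [List.sum_cons, size_cons]
    omega

theorem size_prod_le (l : List ℤ) : size l.prod ≤ size l + 4 := by
  induction l with
  | nil => simp [size_int]
  | cons a l ih =>
    have := size_int_mul_le a l.prod
    rw [List.prod_cons, size_cons]
    omega

namespace PolyTime

variable {α β γ : Type} [Coded α] [Coded β] [Coded γ]

@[fun_prop]
theorem int_toNat {f : α → ℤ} (hf : PolyTime f) : PolyTime fun a => (f a).toNat :=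
  (left.comp (toData.comp hf)).of_toData_eq fun _ => rfl

theorem int_toNat_neg {f : α → ℤ} (hf : PolyTime f) : PolyTime fun a => (-f a).toNat :=
  (right.comp (toData.comp hf)).of_toData_eq fun _ => rfl

@[fun_prop]
theorem natCast_sub_natCast {f g : α → ℕ} (hf : PolyTime f) (hg : PolyTime g) :
    PolyTime fun a => (f a : ℤ) - g a := by
  refine ((hf.nat_sub hg).prodMk (hg.nat_sub hf)).of_toData_eq fun a => ?_
  change Coded.toData (((f a : ℤ) - g a).toNat, (-((f a : ℤ) - g a)).toNat) = _
  rw [neg_sub, Int.toNat_sub, Int.toNat_sub]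

@[fun_prop]
theorem int_natCast {f : α → ℕ} (hf : PolyTime f) : PolyTime fun a => (f a : ℤ) := by
  simpa using hf.natCast_sub_natCast (const 0)

@[fun_prop]
theorem int_neg {f : α → ℤ} (hf : PolyTime f) : PolyTime fun a => -f a := by
  have h (a : α) : -f a = ((-f a).toNat : ℤ) - (f a).toNat := by omega
  rw [funext h]
  exact hf.int_toNat_neg.natCast_sub_natCast hf.int_toNat

@[fun_prop]
theorem natAbs {f : α → ℤ} (hf : PolyTime f) : PolyTime fun a => (f a).natAbs := by
  have h (a : α) : (f a).natAbs = (f a).toNat + (-f a).toNat := by omega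
  rw [funext h]
  fun_prop

@[fun_prop]
theorem int_add {f g : α → ℤ} (hf : PolyTime f) (hg : PolyTime g) :
    PolyTime fun a => f a + g a := by
  have h (a : α) : f a + g a =
      (((f a).toNat + (g a).toNat : ℕ) : ℤ) - ((-f a).toNat + (-g a).toNat : ℕ) := by omega
  rw [funext h]
  fun_prop

@[fun_prop]
theorem int_mul {f g : α → ℤ} (hf : PolyTime f) (hg : PolyTime g) :
    PolyTime fun a => f a * g a := by
  have h (a : α) : f a * g a =
      (((f a).toNat * (g a).toNat + (-f a).toNat * (-g a).toNat : ℕ) : ℤ) -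
        ((f a).toNat * (-g a).toNat + (-f a).toNat * (g a).toNat : ℕ) := by
    conv_lhs => rw [← Int.toNat_sub_toNat_neg (f a), ← Int.toNat_sub_toNat_neg (g a)]
    push_cast
    ring
  rw [funext h]
  fun_prop

@[fun_prop]
theorem int_decide_le {f g : α → ℤ} (hf : PolyTime f) (hg : PolyTime g) :
    PolyTime fun a => decide (f a ≤ g a) := by
  have h (a : α) : decide (f a ≤ g a) =
      decide ((f a).toNat + (-g a).toNat ≤ (g a).toNat + (-f a).toNat) := by
    rw [decide_eq_decide]
    omega
  rw [funext h]
  fun_prop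

instance : PolyTimeEq ℤ where
  decide_eq_prod := by
    simp only [le_antisymm_iff, Bool.decide_and]
    fun_prop

@[fun_prop]
theorem decide_eq [DecidableEq β] [PolyTimeEq β] {f g : α → β} (hf : PolyTime f)
    (hg : PolyTime g) : PolyTime fun a => decide (f a = g a) :=
  PolyTimeEq.decide_eq_prod.comp (hf.prodMk hg)

instance [DecidableEq α] [PolyTimeEq α] [DecidableEq β] [PolyTimeEq β] : PolyTimeEq (α × β) where
  decide_eq_prod := by
    simp only [Prod.ext_iff, Bool.decide_and]
    fun_prop

@[fun_prop]
theorem some {f : α → β} (hf : PolyTime f) : PolyTime fun a => some (f a) :=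
  (hf.cons (const [])).of_toData_eq fun _ => rfl

theorem option_elim {o : γ → Option α} {d : γ → β} {f : γ → α → β} (ho : PolyTime o)
    (hd : PolyTime d) (hf : PolyTime fun p : γ × α => f p.1 p.2) :
    PolyTime fun x => (o x).elim (d x) (f x) := by
  rcases isEmpty_or_nonempty α with hα | ⟨⟨a₀⟩⟩
  · have hnone (x : γ) : o x = none := Option.eq_none_iff_forall_not_mem.2 fun a => isEmptyElim a
    simpa only [hnone, Option.elim_none] using hd
  have : Inhabited α := ⟨a₀⟩
  have hl : PolyTime fun x => (o x).toList := ho.of_toData_eq fun _ => rfl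
  have : PolyTime fun x => f x (o x).toList.headI :=
    hf.comp (f := fun x => (x, (o x).toList.headI)) (by fun_prop)
  have h : PolyTime fun x => bif (o x).toList.isEmpty then d x else f x (o x).toList.headI := by
    fun_prop
  exact h.of_toData_eq fun x => by cases o x <;> rfl

instance [DecidableEq α] [PolyTimeEq α] : PolyTimeEq (Option α) where
  decide_eq_prod := by
    have h (p : Option α × Option α) : decide (p.1 = p.2) =
        p.1.elim (p.2.elim true fun _ => false) fun a =>
          p.2.elim false fun b => decide (a = b) := by
      rcases p with ⟨_ | a, _ | b⟩ <;> simp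
    simp only [h]
    refine option_elim (by fun_prop) (option_elim (by fun_prop) (by fun_prop) (by fun_prop)) ?_
    exact option_elim (by fun_prop) (by fun_prop) (by fun_prop)

@[fun_prop]
theorem filter {l : γ → List α} {p : γ → α → Bool} (hl : PolyTime l)
    (hp : PolyTime fun q : γ × α => p q.1 q.2) : PolyTime fun x => (l x).filter (p x) := by
  have h (p : α → Bool) (l : List α) :
      l.flatMap (fun a => bif p a then [a] else []) = l.filter p := by
    induction l with
    | nil => rfl
    | cons a l ih => cases h : p a <;> simp [ih, h]
  simp only [← h]
  fun_prop

@[fun_prop]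
theorem decide_mem [DecidableEq α] [PolyTimeEq α] {f : γ → α} {l : γ → List α} (hf : PolyTime f)
    (hl : PolyTime l) : PolyTime fun x => decide (f x ∈ l x) := by
  have h (x : γ) : decide (f x ∈ l x) = !((l x).filter fun a => decide (a = f x)).isEmpty := by
    by_cases hx : f x ∈ l x
    · simp [hx]
    · simpa [hx] using fun a ha => ne_of_mem_of_not_mem ha hx
  simp only [h]
  fun_prop

@[fun_prop]
theorem dedup [DecidableEq α] [PolyTimeEq α] {l : γ → List α} (hl : PolyTime l) :
    PolyTime fun x => (l x).dedup := by
  have h (l : List α) :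
      l.foldr (fun a r => bif decide (a ∈ r) then r else a :: r) [] = l.dedup := by
    induction l with
    | nil => rfl
    | cons a l ih => rw [List.foldr_cons, ih, List.dedup_cons', Bool.cond_decide]
  simp only [← h]
  refine foldr (B := fun x => size (l x)) hl (by fun_prop) (by fun_prop) (by fun_prop) ?_
  intro x k
  rw [h]
  exact size_le_of_sublist ((List.dedup_sublist _).trans (List.drop_sublist _ _))

@[fun_prop]
theorem sum {l : α → List ℤ} (hl : PolyTime l) : PolyTime fun a => (l a).sum := by
  simp only [List.sum_eq_foldr]
  refine foldr (B := fun a => size (l a) + 2) hl (by fun_prop) (by fun_prop) (by fun_prop) ?_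
  intro a k
  rw [← List.sum_eq_foldr]
  exact (size_sum_le _).trans (Nat.add_le_add_right (size_le_of_sublist (List.drop_sublist _ _)) 2)

@[fun_prop]
theorem prod {l : α → List ℤ} (hl : PolyTime l) : PolyTime fun a => (l a).prod := by
  simp only [List.prod_eq_foldr]
  refine foldr (B := fun a => size (l a) + 4) hl (by fun_prop) (by fun_prop) (by fun_prop) ?_
  intro a k
  rw [← List.prod_eq_foldr]
  exact (size_prod_le _).trans (Nat.add_le_add_right (size_le_of_sublist (List.drop_sublist _ _)) 4)

@[fun_prop]
theorem dropLast {l : α → List β} (hl : PolyTime l) : PolyTime fun a => (l a).dropLast := by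
  have h (l : List β) : l.dropLast = l.reverse.tail.reverse := by simp
  simp only [h]
  fun_prop

@[fun_prop]
theorem splitOnP {l : α → List β} {p : β → Bool} (hl : PolyTime l) (hp : PolyTime p) :
    PolyTime fun a => (l a).splitOnP p := by
  have h (l : List β) :
      l.foldr (fun b r => bif p b then [] :: r else (b :: r.headI) :: r.tail) [[]] =
        l.splitOnP p := by
    induction l with
    | nil => rfl
    | cons b l ih =>
      obtain ⟨c, r, hr⟩ := List.exists_cons_of_ne_nil (List.splitOnP_ne_nil p l)
      rw [List.foldr_cons, ih, List.splitOnP_cons_eq_if_modifyHead, hr]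
      cases p b <;> rfl
  have : PolyTime fun q : α × β × List (List β) => p q.2.1 := hp.comp (by fun_prop)
  simp only [← h]
  refine foldr (B := fun a => size (l a) + 2) hl (by fun_prop) (by fun_prop) (by fun_prop) ?_
  intro a k
  rw [h]
  exact (size_splitOnP_le _ _).trans
    (Nat.add_le_add_right (size_le_of_sublist (List.drop_sublist _ _)) 2)

end PolyTime

end Prec

/-! ### Numbers and columns as strings -/

namespace Prec

open Function Coded Computability NumberFormat

namespace PolyTime

variable {α β : Type} [Coded α] [Coded β]

theorem of_symbol (f : Symbol → α) : PolyTime f := by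
  have hnode : PolyTime fun s : Symbol => (Coded.toData s).isNode := by fun_prop
  have htrue : PolyTime fun s => decide (s = Symbol.bit true) :=
    (hnode.cond (const (.leaf false)) toData).of_toData_eq fun s => by
      rcases s with ⟨_ | _⟩ | _ | _ | _ <;> rfl
  have hcomma : PolyTime fun s => decide (s = Symbol.comma) :=
    (right.comp (hnode.cond toData (const (.leaf false)))).of_toData_eq fun s => by cases s <;> rfl
  have hsemicolon : PolyTime fun s => decide (s = Symbol.semicolon) :=
    (left.comp (hnode.cond toData (const (.leaf false)))).of_toData_eq fun s => by cases s <;> rfl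
  have h : PolyTime fun s : Symbol => bif decide (s = Symbol.comma) then f .comma
      else bif decide (s = Symbol.semicolon) then f .semicolon
      else bif (Coded.toData s).isNode then f .slash
      else bif decide (s = Symbol.bit true) then f (.bit true) else f (.bit false) := by fun_prop
  exact h.of_toData_eq fun s => by rcases s with ⟨_ | _⟩ | _ | _ | _ <;> rfl

@[fun_prop]
theorem symbol_beq {s : α → Symbol} (hs : PolyTime s) (t : Symbol) : PolyTime fun a => s a == t :=
  (of_symbol (· == t)).comp hs

@[fun_prop]
theorem symbol_bit {b : α → Bool} (hb : PolyTime b) : PolyTime fun a => Symbol.bit (b a) :=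
  hb.of_toData_eq fun _ => rfl

@[fun_prop]
theorem splitOn {l : α → List Symbol} (hl : PolyTime l) (t : Symbol) :
    PolyTime fun a => (l a).splitOn t :=
  hl.splitOnP (of_symbol (· == t))

@[fun_prop]
theorem length {l : α → List β} (hl : PolyTime l) : PolyTime fun a => (l a).length := by
  have h (l : List β) : ((l.map fun _ => (1 : ℤ)).sum).toNat = l.length := by simp
  simp only [← h]
  fun_prop

end PolyTime

section Decode

/-- The integer of absolute value `n` that has the sign announced by a symbol. -/
def signed (s : Symbol) (n : ℕ) : ℤ := bif s == .bit true then -n else n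

theorem natAbs_signed (s : Symbol) (n : ℕ) : (signed s n).natAbs = n := by
  unfold signed
  cases s == .bit true <;> simp

theorem signed_natAbs (a : ℤ) : signed (.bit (decide (a < 0))) a.natAbs = a := by
  by_cases h : a < 0
  · simp only [h, signed, decide_true, beq_self_eq_true, cond_true]
    omega
  · have : (Symbol.bit false == Symbol.bit true) = false := rfl
    simp only [h, signed, decide_false, this, cond_false]
    omega

/-- The number whose binary digits, least significant first, are given as symbols. -/
def decodeNat (l : List Symbol) : ℕ := l.foldr (fun s n => Nat.bit (s == .bit true) n) 0

theorem decodeNat_encodeNat (n : ℕ) : decodeNat ((encodeNat n).map .bit) = n := by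
  induction n using Nat.binaryRec' with
  | zero => rfl
  | bit b n h ih =>
    by_cases h0 : Nat.bit b n = 0
    · rw [h0]
      rfl
    · rw [encodeNat_bit h0]
      change Nat.bit (Symbol.bit b == .bit true) (decodeNat ((encodeNat n).map .bit)) = _
      rw [ih]
      cases b <;> rfl

theorem size_decodeNat_le (l : List Symbol) : size (decodeNat l) ≤ size l := by
  induction l with
  | nil => rfl
  | cons s l ih =>
    have hs := size_pos s
    change size (Nat.bit (s == .bit true) (decodeNat l)) ≤ _
    rw [size_cons]
    by_cases h : Nat.bit (s == .bit true) (decodeNat l) = 0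
    · rw [h, show size 0 = 1 from rfl]
      omega
    · rw [size_bit h]
      omega

/-- The inverse of `encodeBinaryInt` on its range. -/
def decodeBinaryInt (l : List Symbol) : ℤ := signed l.headI (decodeNat l.tail)

theorem decodeBinaryInt_encodeBinaryInt (a : ℤ) : decodeBinaryInt (encodeBinaryInt a) = a := by
  simp only [decodeBinaryInt, encodeBinaryInt, List.headI_cons, List.tail_cons, decodeNat_encodeNat,
    signed_natAbs]

/-- The inverse of `encodeUnaryInt` on its range. -/
def decodeUnaryInt (l : List Symbol) : ℤ := signed l.headI l.tail.length

theorem decodeUnaryInt_encodeUnaryInt (a : ℤ) : decodeUnaryInt (encodeUnaryInt a) = a := by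
  simp only [decodeUnaryInt, encodeUnaryInt, List.headI_cons, List.tail_cons, List.length_replicate,
    signed_natAbs]

namespace PolyTime

variable {α : Type} [Coded α]

@[fun_prop]
theorem signed {s : α → Symbol} {n : α → ℕ} (hs : PolyTime s) (hn : PolyTime n) :
    PolyTime fun a => signed (s a) (n a) := by
  simp only [Prec.signed]
  fun_prop

@[fun_prop]
theorem decodeNat {l : α → List Symbol} (hl : PolyTime l) : PolyTime fun a => decodeNat (l a) := by
  refine foldr (B := fun a => size (l a)) hl (by fun_prop) (by fun_prop) (by fun_prop) fun a k => ?_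
  exact (size_decodeNat_le _).trans (size_le_of_sublist (List.drop_sublist _ _))

@[fun_prop]
theorem decodeBinaryInt {l : α → List Symbol} (hl : PolyTime l) :
    PolyTime fun a => decodeBinaryInt (l a) := by
  simp only [Prec.decodeBinaryInt]
  fun_prop

theorem decodeUnaryInt {l : α → List Symbol} (hl : PolyTime l) :
    PolyTime fun a => decodeUnaryInt (l a) := by
  simp only [Prec.decodeUnaryInt]
  fun_prop

@[fun_prop]
theorem encodeBinaryInt {z : α → ℤ} (hz : PolyTime z) :
    PolyTime fun a => encodeBinaryInt (z a) := by
  have h₁ : PolyTime fun a => encodeNat (z a).natAbs :=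
    hz.natAbs.of_toData_eq fun _ => rfl
  have h₂ (a : α) : decide (z a < 0) = !decide (0 ≤ z a) := by
    rw [← decide_not, decide_eq_decide, not_le]
  simp only [Prec.encodeBinaryInt, h₂]
  fun_prop

end PolyTime

end Decode

instance : DecidableEq Fraction := fun p q =>
  decidable_of_iff (p.num = q.num ∧ p.den = q.den) (by cases p; cases q; simp)

instance : Coded Fraction := ⟨fun q => toData (q.num, q.den)⟩

instance : Coded UnaryInt := ⟨fun a => toData (a.toInt, List.replicate a.toInt.natAbs true)⟩

theorem natAbs_toInt_le_size (a : UnaryInt) : a.toInt.natAbs ≤ size a := by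
  have h := length_lt_size (List.replicate a.toInt.natAbs true)
  have ha : size a = size a.toInt + size (List.replicate a.toInt.natAbs true) + 1 :=
    size_prod (a.toInt, List.replicate a.toInt.natAbs true)
  rw [List.length_replicate] at h
  omega

instance : Mul Fraction := ⟨fun p q => ⟨p.num * q.num, p.den * q.den, mul_ne_zero p.3 q.3⟩⟩

instance : Mul UnaryInt := ⟨fun a b => ⟨a.toInt * b.toInt⟩⟩

/-- Comparison of the represented numbers. -/
def leRat {V : Type} [NumberFormat V] (v w : V) : Bool := decide (toRat v ≤ toRat w)

/-- Number formats for which decoding, multiplication and comparison take polynomial time. -/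
class PolyTimeFormat (V : Type) [NumberFormat V] [Coded V] [Mul V] where
  /-- the number that is written as a given string -/
  decode : List Symbol → V
  decode_encode (v : V) : decode (encode v) = v
  comma_notMem_encode (v : V) : Symbol.comma ∉ encode v
  semicolon_notMem_encode (v : V) : Symbol.semicolon ∉ encode v
  toRat_mul (v w : V) : toRat (v * w) = toRat v * toRat w
  polyTime_decode : PolyTime decode
  polyTime_mul : PolyTime fun p : V × V => p.1 * p.2
  polyTime_leRat : PolyTime fun p : V × V => leRat p.1 p.2

namespace PolyTime

variable {α β : Type} [Coded α] [Coded β]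

theorem fraction_mk {n d : α → ℤ} (hn : PolyTime n) (hd : PolyTime d) (h : ∀ a, d a ≠ 0) :
    PolyTime fun a => (⟨n a, d a, h a⟩ : Fraction) :=
  (hn.prodMk hd).of_toData_eq fun _ => rfl

@[fun_prop]
theorem fraction_num {f : α → Fraction} (hf : PolyTime f) : PolyTime fun a => (f a).num := by
  have h : PolyTime fun a => ((f a).num, (f a).den) := hf.of_toData_eq fun _ => rfl
  exact h.fst

@[fun_prop]
theorem fraction_den {f : α → Fraction} (hf : PolyTime f) : PolyTime fun a => (f a).den := by
  have h : PolyTime fun a => ((f a).num, (f a).den) := hf.of_toData_eq fun _ => rfl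
  exact h.snd

instance : PolyTimeEq Fraction where
  decide_eq_prod := by
    have h (p q : Fraction) : p = q ↔ p.num = q.num ∧ p.den = q.den := by
      cases p
      cases q
      simp
    simp only [h, Bool.decide_and]
    fun_prop

@[fun_prop]
theorem unaryInt_toInt {f : α → UnaryInt} (hf : PolyTime f) : PolyTime fun a => (f a).toInt := by
  have h : PolyTime fun a => ((f a).toInt, List.replicate (f a).toInt.natAbs true) :=
    hf.of_toData_eq fun _ => rfl
  exact h.fst

@[fun_prop]
theorem replicate_natAbs_toInt {f : α → UnaryInt} (hf : PolyTime f) :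
    PolyTime fun a => List.replicate (f a).toInt.natAbs true := by
  have h : PolyTime fun a => ((f a).toInt, List.replicate (f a).toInt.natAbs true) :=
    hf.of_toData_eq fun _ => rfl
  exact h.snd

theorem unaryInt_mk {z : α → ℤ} {u : α → List β} (hz : PolyTime z) (hu : PolyTime u)
    (h : ∀ a, (u a).length = (z a).natAbs) : PolyTime fun a => UnaryInt.mk (z a) := by
  have hrep : PolyTime fun a => (u a).map fun _ => true := by fun_prop
  refine (hz.prodMk hrep).of_toData_eq fun a => ?_
  rw [List.map_const', h]
  rfl

theorem encode_fraction {f : α → Fraction} (hf : PolyTime f) : PolyTime fun a => encode (f a) := by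
  simp only [encode]
  fun_prop

end PolyTime

theorem bit_of_mem_encodeBinaryInt {a : ℤ} {s : Symbol} (h : s ∈ encodeBinaryInt a) :
    ∃ b, s = .bit b := by
  rcases List.mem_cons.1 h with rfl | h
  · exact ⟨_, rfl⟩
  · obtain ⟨b, -, rfl⟩ := List.mem_map.1 h
    exact ⟨b, rfl⟩

theorem bit_of_mem_encodeUnaryInt {a : ℤ} {s : Symbol} (h : s ∈ encodeUnaryInt a) :
    ∃ b, s = .bit b := by
  rcases List.mem_cons.1 h with rfl | h
  · exact ⟨_, rfl⟩
  · exact ⟨_, List.eq_of_mem_replicate h⟩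

theorem bit_or_slash_of_mem_encode_fraction {q : Fraction} {s : Symbol} (h : s ∈ encode q) :
    s = .slash ∨ ∃ b, s = .bit b := by
  rcases List.mem_append.1 h with h | h
  · exact .inr (bit_of_mem_encodeBinaryInt h)
  · exact (List.mem_cons.1 h).imp_right bit_of_mem_encodeBinaryInt

theorem splitOn_encode_fraction (q : Fraction) :
    (encode q).splitOn .slash = [encodeBinaryInt q.num, encodeBinaryInt q.den] := by
  have hslash (a : ℤ) : Symbol.slash ∉ encodeBinaryInt a := fun h => by
    simpa using bit_of_mem_encodeBinaryInt h
  change (encodeBinaryInt q.num ++ Symbol.slash :: encodeBinaryInt q.den).splitOn _ = _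
  rw [List.splitOn_append_cons_self_of_not_mem (hslash _), List.splitOn_eq_singleton (hslash _)]

theorem fraction_toRat_le_iff (p q : Fraction) :
    toRat p ≤ toRat q ↔ p.num * p.den * (q.den * q.den) ≤ q.num * q.den * (p.den * p.den) := by
  have hp : (p.den : ℚ) ≠ 0 := mod_cast p.den_ne_zero
  have hq : (q.den : ℚ) ≠ 0 := mod_cast q.den_ne_zero
  have hp' : 0 < (p.den * p.den : ℚ) := mul_self_pos.2 hp
  have hq' : 0 < (q.den * q.den : ℚ) := mul_self_pos.2 hq
  change (p.num : ℚ) / p.den ≤ q.num / q.den ↔ _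
  rw [← mul_div_mul_right _ _ hp, ← mul_div_mul_right (q.num : ℚ) _ hq, div_le_div_iff₀ hp' hq']
  exact_mod_cast Iff.rfl

/-- The fraction written as a given string; if the denominator read is `0`, it is replaced
by `1`. -/
def decodeFraction (l : List Symbol) : Fraction where
  num := decodeBinaryInt (l.splitOn .slash).headI
  den :=
    let d := decodeBinaryInt (l.splitOn .slash).tail.headI
    bif decide (d = 0) then 1 else d
  den_ne_zero := by
    by_cases h : decodeBinaryInt (l.splitOn .slash).tail.headI = 0 <;> simp [h]

theorem decodeFraction_encode (q : Fraction) : decodeFraction (encode q) = q := by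
  simp [decodeFraction, splitOn_encode_fraction, decodeBinaryInt_encodeBinaryInt, q.den_ne_zero]

theorem PolyTime.decodeFraction : PolyTime decodeFraction := by
  have hparts : PolyTime fun l : List Symbol => l.splitOn .slash := by fun_prop
  have hnum := hparts.headI.decodeBinaryInt
  have hden := hparts.tail.headI.decodeBinaryInt
  exact fraction_mk hnum (((hden.decide_eq (const 0)).cond (const 1) hden)) _

instance : PolyTimeFormat Fraction where
  decode := decodeFraction
  decode_encode := decodeFraction_encode
  comma_notMem_encode q h := by simpa using bit_or_slash_of_mem_encode_fraction h
  semicolon_notMem_encode q h := by simpa using bit_or_slash_of_mem_encode_fraction h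
  toRat_mul p q := by
    change ((p.num * q.num : ℤ) : ℚ) / (p.den * q.den : ℤ) = _
    push_cast
    exact mul_div_mul_comm ..
  polyTime_decode := PolyTime.decodeFraction
  polyTime_mul := PolyTime.fraction_mk (by fun_prop) (by fun_prop) _
  polyTime_leRat := by
    simp only [leRat, fraction_toRat_le_iff]
    fun_prop

instance : PolyTimeFormat UnaryInt where
  decode l := ⟨decodeUnaryInt l⟩
  decode_encode a := congrArg _ (decodeUnaryInt_encodeUnaryInt a.toInt)
  comma_notMem_encode a h := by simpa using bit_of_mem_encodeUnaryInt h
  semicolon_notMem_encode a h := by simpa using bit_of_mem_encodeUnaryInt h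
  toRat_mul a b := Int.cast_mul a.toInt b.toInt
  polyTime_decode := by
    have htail : PolyTime fun l : List Symbol => l.tail := by fun_prop
    exact PolyTime.id.decodeUnaryInt.unaryInt_mk htail fun l => (natAbs_signed _ _).symm
  polyTime_mul := by
    have hdigits : PolyTime fun p : UnaryInt × UnaryInt =>
        (List.replicate p.1.toInt.natAbs true).flatMap fun _ =>
          List.replicate p.2.toInt.natAbs true := by fun_prop
    refine PolyTime.unaryInt_mk (by fun_prop) hdigits fun p => ?_
    simp [Int.natAbs_mul]
  polyTime_leRat := by
    have h (p : UnaryInt × UnaryInt) : leRat p.1 p.2 = decide (p.1.toInt ≤ p.2.toInt) :=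
      decide_eq_decide.2 Int.cast_le
    rw [funext h]
    fun_prop

end Prec

/-! ### Reading the input -/

namespace Prec

open Coded NumberFormat PolyTimeFormat

namespace PolyTime

variable {α V : Type} [Coded α] [NumberFormat V] [Coded V] [Mul V] [PolyTimeFormat V]

@[fun_prop]
theorem decode {l : α → List Symbol} (hl : PolyTime l) : PolyTime fun a => (decode (l a) : V) :=
  polyTime_decode.comp hl

@[fun_prop]
theorem format_mul {v w : α → V} (hv : PolyTime v) (hw : PolyTime w) :
    PolyTime fun a => v a * w a :=
  (polyTime_mul (V := V)).comp (hv.prodMk hw)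

@[fun_prop]
theorem leRat {v w : α → V} (hv : PolyTime v) (hw : PolyTime w) :
    PolyTime fun a => leRat (v a) (w a) := by
  have h := (polyTime_leRat (V := V)).comp (hv.prodMk hw)
  exact h

end PolyTime

section Blocks

/-- The segments of a list that are closed by the separator `t`. -/
def blocks (t : Symbol) (l : List Symbol) : List (List Symbol) := (l.splitOn t).dropLast

theorem blocks_flatMap_append {t : Symbol} {l : List (List Symbol)} (hl : ∀ b ∈ l, t ∉ b) :
    blocks t (l.flatMap (· ++ [t])) = l := by
  suffices h : (l.flatMap (· ++ [t])).splitOn t = l ++ [[]] by rw [blocks, h, List.dropLast_concat]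
  induction l with
  | nil => rfl
  | cons b l ih =>
    rw [List.forall_mem_cons] at hl
    rw [List.flatMap_cons, List.append_assoc, List.singleton_append,
      List.splitOn_append_cons_self_of_not_mem hl.1, ih hl.2, List.cons_append]

/-- The consecutive disjoint pairs of entries of a list. -/
def pairUp {β : Type} : List β → List (β × β)
  | a :: b :: l => (a, b) :: pairUp l
  | _ => []

theorem pairUp_flatMap {α β : Type} (f g : α → β) (l : List α) :
    pairUp (l.flatMap fun a => [f a, g a]) = l.map fun a => (f a, g a) := by
  induction l with
  | nil => rfl
  | cons a l ih => simpa [pairUp] using ih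

theorem size_pairUp_le {β : Type} [Coded β] : ∀ l : List β, size (pairUp l) ≤ size l
  | [] | [_] => by simp [pairUp]
  | a :: b :: l => by
    have := size_pairUp_le l
    simp only [pairUp, size_cons, size_prod]
    omega

namespace PolyTime

variable {α β : Type} [Coded α] [Coded β]

@[fun_prop]
theorem blocks {l : α → List Symbol} (hl : PolyTime l) (t : Symbol) :
    PolyTime fun a => blocks t (l a) := by
  simp only [Prec.blocks]
  fun_prop

@[fun_prop]
theorem pairUp [Inhabited β] {l : α → List β} (hl : PolyTime l) :
    PolyTime fun a => pairUp (l a) := by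
  have h : PolyTime (Prec.pairUp : List β → _) := by
    refine linearRec (c := fun l : List β => l.tail.isEmpty) (n := fun l => l.tail.tail)
      (g := fun _ => []) (h := fun l r => (l.headI, l.tail.headI) :: r) (μ := List.length)
      (by fun_prop) (by fun_prop) (by fun_prop) (by fun_prop) (fun l => ?_) (fun l hl => ?_)
      (PolyBounded.size_self.mono fun l => (length_lt_size l).le)
      (fun l => size_le_of_sublist ((List.tail_sublist _).trans (List.tail_sublist _)))
      (PolyBounded.size_self.mono size_pairUp_le)
    · match l with
      | [] | [_] | _ :: _ :: _ => rfl
    · match l with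
      | _ :: _ :: l =>
        simp only [List.tail_cons, List.length_cons]
        omega
  exact h.comp hl

end PolyTime

end Blocks

/-- A finite distribution, as a list of outcome-probability pairs. -/
abbrev Law (α : Type) := List (α × Fraction)

variable {V : Type} [NumberFormat V]

section Column

variable [Mul V]

/-- The law of the `j`-th column of the weighted matrix. -/
def Input.column (x : Input V) (j : Fin x.cols) : Law (V × V) :=
  (x.dist j).pairs.map fun e => ((x.matrix 0 j * e.1, x.matrix 1 j * e.1), e.2)

variable [Coded V] [PolyTimeFormat V]

/-- The law of a column of the weighted matrix, read off its encoding. -/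
def decodeColumn (l : List Symbol) : Law (V × V) :=
  let b := blocks .comma l
  (pairUp b.tail.tail).map fun e =>
    ((decode b.headI * decode e.1, decode b.tail.headI * decode e.1), decodeFraction e.2)

/-- The laws of the columns of the weighted matrix, read off the encoding of an input. -/
def decodeInput (l : List Symbol) : List (Law (V × V)) := (blocks .semicolon l).map decodeColumn

theorem PolyTime.decodeColumn : PolyTime (decodeColumn (V := V)) := by
  have hfraction := decodeFraction
  unfold Prec.decodeColumn
  fun_prop

theorem PolyTime.decodeInput : PolyTime (decodeInput (V := V)) := by
  have hcolumn := decodeColumn (V := V)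
  unfold Prec.decodeInput
  fun_prop

end Column

namespace Input

/-- The numbers by which a column of an input is described. -/
def fields (x : Input V) (j : Fin x.cols) : List (List Symbol) :=
  NumberFormat.encode (x.matrix 0 j) :: NumberFormat.encode (x.matrix 1 j) ::
    (x.dist j).pairs.flatMap fun e => [NumberFormat.encode e.1, NumberFormat.encode e.2]

theorem encodeColumn_eq (x : Input V) (j : Fin x.cols) :
    x.encodeColumn j = (x.fields j).flatMap (· ++ [.comma]) ++ [.semicolon] := by
  simp [encodeColumn, fields, List.flatMap_assoc]

theorem encode_eq (x : Input V) :
    x.encode = (List.ofFn fun j => (x.fields j).flatMap (· ++ [.comma])).flatMap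
      (· ++ [.semicolon]) := by
  rw [encode, funext x.encodeColumn_eq, List.flatMap, List.map_ofFn]
  rfl

theorem notMem_of_mem_fields {t : Symbol} (ht : ∀ v : V, t ∉ NumberFormat.encode v)
    (ht' : ∀ q : Fraction, t ∉ NumberFormat.encode q) (x : Input V) (j : Fin x.cols) :
    ∀ b ∈ x.fields j, t ∉ b := by
  simp only [fields, List.mem_cons, List.mem_flatMap]
  rintro b (rfl | rfl | ⟨e, -, rfl | rfl | h⟩)
  exacts [ht _, ht _, ht _, ht' _, absurd h List.not_mem_nil]

variable [Coded V] [Mul V] [PolyTimeFormat V]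

theorem decodeColumn_flatMap_fields (x : Input V) (j : Fin x.cols) :
    decodeColumn ((x.fields j).flatMap (· ++ [.comma])) = x.column j := by
  have h := blocks_flatMap_append
    (x.notMem_of_mem_fields comma_notMem_encode comma_notMem_encode j)
  rw [decodeColumn, h]
  simp [fields, column, pairUp_flatMap, decode_encode, decodeFraction_encode]

theorem decodeInput_encode (x : Input V) : decodeInput x.encode = List.ofFn x.column := by
  rw [decodeInput, encode_eq, blocks_flatMap_append, List.map_ofFn]
  · exact congrArg _ (funext x.decodeColumn_flatMap_fields)
  · intro b hb
    obtain ⟨j, rfl⟩ := (List.mem_ofFn' _ _).1 hb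
    simpa using x.notMem_of_mem_fields semicolon_notMem_encode semicolon_notMem_encode j

end Input

end Prec

/-! ### Dynamic programming on the distribution of a state -/

namespace Prec

open Coded NumberFormat

/-- A finite signed measure, as a list of outcomes with integer weights; the weights of the
occurrences of an outcome add up. -/
abbrev Table (α : Type) := List (α × ℤ)

section Integral

variable {α β σ : Type}

/-- The integral of `φ` with respect to a list of outcomes of which `w` gives the weights. -/
def integral (w : β → ℚ) (l : List (α × β)) (φ : α → ℚ) : ℚ := (l.map fun e => w e.2 * φ e.1).sum

theorem integral_cons (w : β → ℚ) (e : α × β) (l : List (α × β)) (φ : α → ℚ) :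
    integral w (e :: l) φ = w e.2 * φ e.1 + integral w l φ := rfl

theorem integral_append (w : β → ℚ) (l k : List (α × β)) (φ : α → ℚ) :
    integral w (l ++ k) φ = integral w l φ + integral w k φ := by
  rw [integral, List.map_append, List.sum_append]
  rfl

theorem integral_const_mul (w : β → ℚ) (l : List (α × β)) (c : ℚ) (φ : α → ℚ) :
    integral w l (fun a => c * φ a) = c * integral w l φ := by
  simp only [integral, mul_left_comm _ c, List.sum_map_mul_left]

theorem integral_map (f : α → σ) (c : ℤ) (t : Table α) (φ : σ → ℚ) :
    integral (↑) (t.map fun e => (f e.1, c * e.2)) φ = c * integral (↑) t fun a => φ (f a) := by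
  simp only [integral, List.map_map, Function.comp_def, Int.cast_mul, mul_assoc,
    List.sum_map_mul_left]

end Integral

section CommonDenominator

variable {α : Type}

/-- The product of the denominators of the probabilities of a law. -/
def commonDenominator (d : Law α) : ℤ := (d.map fun e => e.2.den).prod

theorem commonDenominator_cons (e : α × Fraction) (d : Law α) :
    commonDenominator (e :: d) = e.2.den * commonDenominator d := rfl

theorem commonDenominator_ne_zero (d : Law α) : commonDenominator d ≠ 0 := by
  simp [commonDenominator, List.prod_eq_zero_iff, Fraction.den_ne_zero]

/-- The probabilities of a law multiplied by their common denominator. -/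
def numerators : Law α → Table α
  | [] => []
  | e :: d => (e.1, e.2.num * commonDenominator d) ::
      (numerators d).map fun v => (v.1, e.2.den * v.2)

theorem integral_numerators (d : Law α) (φ : α → ℚ) :
    integral (↑) (numerators d) φ = commonDenominator d * integral toRat d φ := by
  induction d with
  | nil => simp [numerators, integral]
  | cons e d ih =>
    have hden : (e.2.den : ℚ) ≠ 0 := mod_cast e.2.den_ne_zero
    have he : toRat e.2 = (e.2.num : ℚ) / e.2.den := rfl
    rw [numerators, integral_cons, integral_map (fun a => a), ih, integral_cons, he]
    rw [commonDenominator_cons, Int.cast_mul, Int.cast_mul]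
    field_simp

theorem map_fst_numerators (d : Law α) : (numerators d).map Prod.fst = d.map Prod.fst := by
  induction d with
  | nil => rfl
  | cons e d ih => simp [numerators, Function.comp_def, ih]

variable [Coded α]

theorem size_fraction (q : Fraction) : size q = size q.num + size q.den + 1 :=
  size_prod (q.num, q.den)

theorem size_commonDenominator_le (d : Law α) : size (commonDenominator d) ≤ size d + 4 := by
  induction d with
  | nil => simp [commonDenominator, size_int]
  | cons e d ih =>
    have := size_int_mul_le e.2.den (commonDenominator d)
    simp only [commonDenominator_cons, size_cons, size_prod, size_fraction]
    omega

theorem size_le_of_mem_numerators {d : Law α} {v : α × ℤ} (hv : v ∈ numerators d) :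
    size v ≤ 2 * size d + 4 := by
  suffices h : size v.1 ≤ size d ∧ size v.2 ≤ size d + 3 by
    rw [size_prod]
    omega
  induction d generalizing v with
  | nil => cases hv
  | cons e d ih =>
    have hd := size_commonDenominator_le d
    simp only [size_cons, size_prod, size_fraction]
    rcases List.mem_cons.1 hv with rfl | hv
    · have := size_int_mul_le e.2.num (commonDenominator d)
      dsimp only
      omega
    · obtain ⟨v, hv', rfl⟩ := List.mem_map.1 hv
      have := size_int_mul_le e.2.den v.2
      have := ih hv'
      dsimp only
      omega

theorem size_numerators_le (d : Law α) : size (numerators d) ≤ size d * (2 * size d + 5) + 1 := by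
  have h := size_list_le fun _ => size_le_of_mem_numerators (d := d)
  have hlength : (numerators d).length = d.length := by
    simpa using congrArg List.length (map_fst_numerators d)
  rw [hlength] at h
  exact h.trans (by gcongr; exact (length_lt_size d).le)

namespace PolyTime

variable {γ : Type} [Coded γ]

@[fun_prop]
theorem commonDenominator {d : γ → Law α} (hd : PolyTime d) :
    PolyTime fun x => commonDenominator (d x) := by
  simp only [Prec.commonDenominator]
  fun_prop

@[fun_prop]
theorem numerators {d : γ → Law α} (hd : PolyTime d) : PolyTime fun x => numerators (d x) := by
  have hfoldr (d : Law α) : d.foldr (fun e r =>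
      ((e.1, e.2.num * r.2) :: r.1.map fun v => (v.1, e.2.den * v.2), e.2.den * r.2)) ([], 1) =
      (Prec.numerators d, Prec.commonDenominator d) := by
    induction d with
    | nil => rfl
    | cons e d ih => rw [List.foldr_cons, ih]; rfl
  have h := foldr (B := fun x => size (d x) * (2 * size (d x) + 5) + 1 + (size (d x) + 4) + 1)
    (i := fun _ => (([], 1) : Table α × ℤ)) (f := fun _ e r =>
      ((e.1, e.2.num * r.2) :: r.1.map fun v => (v.1, e.2.den * v.2), e.2.den * r.2))
    hd (by fun_prop) (by fun_prop) (by fun_prop) fun x k => ?_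
  · simp only [hfoldr] at h
    exact h.fst
  · have hk : size ((d x).drop k) ≤ size (d x) := size_le_of_sublist (List.drop_sublist _ _)
    have hmul := Nat.mul_le_mul hk (Nat.add_le_add_right (Nat.mul_le_mul_left 2 hk) 5)
    have := size_numerators_le ((d x).drop k)
    have := size_commonDenominator_le ((d x).drop k)
    rw [hfoldr, size_prod]
    dsimp only
    omega

end PolyTime

end CommonDenominator

section Merge

theorem sum_fiberwise {α κ R : Type*} [DecidableEq κ] [Semiring R] (l : List α) (k : α → κ)
    (w : α → R) (G : κ → R) :
    ∑ q ∈ (l.map k).toFinset, ((l.filter fun a => k a = q).map w).sum * G q =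
      (l.map fun a => w a * G (k a)).sum := by
  suffices h : ∀ s : Finset κ, (∀ a ∈ l, k a ∈ s) →
      ∑ q ∈ s, ((l.filter fun a => k a = q).map w).sum * G q =
        (l.map fun a => w a * G (k a)).sum from
    h _ fun a ha => List.mem_toFinset.2 (List.mem_map_of_mem ha)
  intro s hs
  induction l with
  | nil => simp
  | cons a l ih =>
    rw [List.forall_mem_cons] at hs
    have hsplit (q : κ) : (((a :: l).filter fun a => k a = q).map w).sum * G q =
        (if q = k a then w a * G q else 0) + ((l.filter fun a => k a = q).map w).sum * G q := by
      by_cases h : q = k a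
      · simp [h, add_mul]
      · simp [h, Ne.symm h]
    simp only [hsplit, Finset.sum_add_distrib, Finset.sum_ite_eq', if_pos hs.1, ih hs.2,
      List.map_cons, List.sum_cons]

theorem sum_toFinset_eq_sum_dedup {α M : Type*} [DecidableEq α] [AddCommMonoid M] (l : List α)
    (f : α → M) : ∑ a ∈ l.toFinset, f a = (l.dedup.map f).sum := rfl

variable {σ : Type} [DecidableEq σ]

/-- The measure given by a table, with every outcome listed once. -/
def merge (t : Table σ) : Table σ :=
  (t.map Prod.fst).dedup.map fun s => (s, ((t.filter fun e => e.1 = s).map Prod.snd).sum)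

theorem map_fst_merge (t : Table σ) : (merge t).map Prod.fst = (t.map Prod.fst).dedup := by
  simp [merge, Function.comp_def]

theorem integral_merge (t : Table σ) (φ : σ → ℚ) : integral (↑) (merge t) φ = integral (↑) t φ := by
  have h := sum_fiberwise t Prod.fst (fun e => (e.2 : ℚ)) φ
  rw [sum_toFinset_eq_sum_dedup] at h
  simpa [integral, merge, Function.comp_def, Int.cast_list_sum] using h

/-- The total variation of the measure given by a table without repeated outcomes. -/
def absSum (t : Table σ) : ℤ := (t.map fun e => |e.2|).sum

theorem absSum_merge_le (t : Table σ) : absSum (merge t) ≤ absSum t := by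
  have h := sum_fiberwise t Prod.fst (fun e => |e.2|) 1
  rw [sum_toFinset_eq_sum_dedup] at h
  simp only [Pi.one_apply, mul_one] at h
  rw [absSum, absSum, ← h, merge, List.map_map]
  refine List.sum_le_sum fun s _ => ?_
  exact (List.le_sum_of_subadditive _ abs_zero.le abs_add_le _).trans_eq
    (by simp [Function.comp_def])

end Merge
end Prec

/-! ### The recursion over the columns -/

namespace Prec

open Coded NumberFormat

section AbsSum

variable {σ : Type}

theorem size_int_le_of_abs_le {a b : ℤ} (h : |a| ≤ b) : size a ≤ size b := by
  rw [Int.abs_eq_natAbs] at h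
  have := size_nat_mono (m := a.natAbs) (n := b.natAbs) (by omega)
  rw [size_int_eq_size_natAbs, size_int_eq_size_natAbs]
  omega

theorem size_le_size_absSum {t : Table σ} {e : σ × ℤ} (he : e ∈ t) : size e.2 ≤ size (absSum t) :=
  size_int_le_of_abs_le <| List.single_le_sum
    (List.forall_mem_map.2 fun _ _ => abs_nonneg _) _ (List.mem_map_of_mem he)

theorem absSum_nonneg (t : Table σ) : 0 ≤ absSum t :=
  List.sum_nonneg (List.forall_mem_map.2 fun _ _ => abs_nonneg _)

variable [Coded σ]

theorem size_absSum_le (t : Table σ) : size (absSum t) ≤ size t + 2 := by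
  induction t with
  | nil => simp [absSum, size_int]
  | cons e t ih =>
    have hadd := size_int_add_le |e.2| (absSum t)
    have habs : size |e.2| ≤ size e.2 := by
      rw [size_int_eq_size_natAbs, Int.natAbs_abs, ← size_int_eq_size_natAbs]
    have hsum : absSum (e :: t) = |e.2| + absSum t := rfl
    rw [hsum, size_cons, size_prod]
    omega

end AbsSum

section Table

variable {α σ : Type} [DecidableEq σ] (upd : α → σ → σ) (base : σ)

/-- The distribution of the state `upd o s` for independent `o` and `s` with distributions `c`
and `t`. -/
def step (c : Table α) (t : Table σ) : Table σ :=
  merge (c.flatMap fun o => t.map fun s => (upd o.1 s.1, o.2 * s.2))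

/-- The distribution of the state reached from `base` by independent outcomes with the given
distributions. -/
def table (l : List (Table α)) : Table σ := l.foldr (step upd) [(base, 1)]

theorem table_cons (c : Table α) (l : List (Table α)) :
    table upd base (c :: l) = step upd c (table upd base l) := rfl

theorem integral_step (c : Table α) (t : Table σ) (φ : σ → ℚ) :
    integral (↑) (step upd c t) φ =
      integral (↑) c fun a => integral (↑) t fun s => φ (upd a s) := by
  rw [step, integral_merge]
  induction c with
  | nil => rfl
  | cons o c ih => rw [List.flatMap_cons, integral_append, integral_map, ih, integral_cons]

theorem absSum_step_le (c : Table α) (t : Table σ) :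
    absSum (step upd c t) ≤ absSum c * absSum t := by
  refine (absSum_merge_le _).trans_eq ?_
  induction c with
  | nil => simp [absSum]
  | cons o c ih =>
    simp only [absSum] at ih
    simp [absSum, Function.comp_def, abs_mul, List.sum_map_mul_left, add_mul, ih]

theorem nodup_map_fst_table (l : List (Table α)) : ((table upd base l).map Prod.fst).Nodup := by
  cases l with
  | nil => exact List.nodup_singleton _
  | cons c l =>
    rw [table_cons, step, map_fst_merge]
    exact List.nodup_dedup _

theorem forall_mem_table {P : ℕ → σ → Prop} (l : List (Table α)) (h0 : P 0 base)
    (hstep : ∀ c ∈ l, ∀ e ∈ c, ∀ n s, P n s → P (n + 1) (upd e.1 s)) :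
    ∀ e ∈ table upd base l, P l.length e.1 := by
  induction l with
  | nil => simpa [table] using h0
  | cons c l ih =>
    rw [List.forall_mem_cons] at hstep
    intro e he
    replace he := List.mem_map_of_mem (f := Prod.fst) he
    rw [table_cons, step, map_fst_merge, List.mem_dedup] at he
    simp only [List.mem_map, List.mem_flatMap] at he
    obtain ⟨_, ⟨o, ho, s, hs, rfl⟩, heq⟩ := he
    rw [← heq]
    exact hstep.1 o ho _ _ (ih hstep.2 s hs)

variable [Coded α]

theorem size_absSum_table_le (l : List (Table α)) :
    size (absSum (table upd base l)) ≤ 3 * size l + 2 := by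
  induction l with
  | nil => simp [table, absSum, size_int]
  | cons c l ih =>
    have hstep := absSum_step_le upd c (table upd base l)
    have := size_int_le_of_abs_le ((abs_of_nonneg (absSum_nonneg _)).trans_le hstep)
    have := size_int_mul_le (absSum c) (absSum (table upd base l))
    have := size_absSum_le c
    rw [table_cons, size_cons]
    omega

variable [Coded σ]

theorem size_table_le {K : Finset σ} {B : ℕ} (hB : ∀ s ∈ K, size s ≤ B) (l : List (Table α))
    (hK : ∀ e ∈ table upd base l, e.1 ∈ K) :
    size (table upd base l) ≤ K.card * (B + (3 * size l + 2) + 2) + 1 := by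
  have hsize : ∀ e ∈ table upd base l, size e ≤ B + (3 * size l + 2) + 1 := fun e he => by
    rw [size_prod]
    have := hB _ (hK e he)
    have := size_le_size_absSum he
    have := size_absSum_table_le upd base l
    omega
  have hlength : (table upd base l).length ≤ K.card := by
    rw [← List.length_map Prod.fst, ← List.toFinset_card_of_nodup (nodup_map_fst_table upd base l)]
    exact Finset.card_le_card fun s hs => by
      obtain ⟨e, he, rfl⟩ := List.mem_map.1 (List.mem_toFinset.1 hs)
      exact hK e he
  exact (size_list_le hsize).trans (by gcongr)

end Table

namespace PolyTime

variable {α σ γ : Type} [Coded α] [Coded σ] [DecidableEq σ] [PolyTimeEq σ] [Coded γ]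

@[fun_prop]
theorem merge {t : γ → Table σ} (ht : PolyTime t) : PolyTime fun x => merge (t x) := by
  unfold Prec.merge
  fun_prop

theorem step {upd : α → σ → σ} (hupd : PolyTime fun p : α × σ => upd p.1 p.2) {c : γ → Table α}
    {t : γ → Table σ} (hc : PolyTime c) (ht : PolyTime t) :
    PolyTime fun x => step upd (c x) (t x) := by
  have : PolyTime fun p : (γ × α × ℤ) × σ × ℤ => upd p.1.2.1 p.2.1 :=
    hupd.comp (f := fun p : (γ × α × ℤ) × σ × ℤ => (p.1.2.1, p.2.1)) (by fun_prop)
  unfold Prec.step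
  fun_prop

theorem table {upd : α → σ → σ} (hupd : PolyTime fun p : α × σ => upd p.1 p.2) (base : σ)
    {l : γ → List (Table α)} (hl : PolyTime l) {K : γ → ℕ → Finset σ} {N : γ → ℕ}
    (hN : PolyBounded N) (hcard : ∀ x, ∀ n ≤ (l x).length, (K x n).card ≤ N x)
    (hsize : ∀ x, ∀ n ≤ (l x).length, ∀ s ∈ K x n, size s ≤ N x) (hbase : ∀ x, base ∈ K x 0)
    (hstep : ∀ x, ∀ c ∈ l x, ∀ e ∈ c, ∀ n, ∀ s ∈ K x n, upd e.1 s ∈ K x (n + 1)) :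
    PolyTime fun x => table upd base (l x) := by
  refine foldr (B := fun x => N x * (N x + (3 * size (l x) + 2) + 2) + 1) hl (const _)
    (step hupd (by fun_prop) (by fun_prop)) (by fun_prop) fun x k => ?_
  have hk : ((l x).drop k).Sublist (l x) := List.drop_sublist _ _
  have htable := forall_mem_table upd base ((l x).drop k) (P := fun n s => s ∈ K x n) (hbase x)
    fun c hc => hstep x c (hk.mem hc)
  refine (size_table_le upd base (hsize x _ hk.length_le) _ htable).trans ?_
  gcongr
  · exact hcard x _ hk.length_le
  · exact size_le_of_sublist hk

end PolyTime
end Prec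

/-! ### Probabilities of the states -/

namespace Prec

open Coded NumberFormat

section Expect

variable {α σ : Type}

/-- The expectation of `F` at the list of independent outcomes with the given laws. -/
def expect : List (Law α) → (List α → ℚ) → ℚ
  | [], F => F []
  | d :: l, F => integral toRat d fun a => expect l fun o => F (a :: o)

theorem integral_table [DecidableEq σ] (upd : α → σ → σ) (base : σ) (laws : List (Law α))
    (φ : σ → ℚ) : integral (↑) (table upd base (laws.map numerators)) φ =
      (laws.map commonDenominator).prod * expect laws fun o => φ (o.foldr upd base) := by
  induction laws generalizing φ with
  | nil => simp [table, integral, expect]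
  | cons d l ih =>
    simp only [List.map_cons, table_cons, integral_step, ih, integral_const_mul,
      integral_numerators, expect, List.foldr_cons, List.prod_cons, Int.cast_mul]
    ring

theorem sum_piFinset_succ {n : ℕ} (S : Fin (n + 1) → Finset ℚ) (F : (Fin (n + 1) → ℚ) → ℚ) :
    ∑ u ∈ Fintype.piFinset S, F u =
      ∑ q ∈ S 0, ∑ u ∈ Fintype.piFinset fun j => S j.succ, F (Fin.cons q u) := by
  rw [← Finset.sum_product']
  refine Finset.sum_equiv (Fin.consEquiv _).symm (fun u => ?_) fun u _ => ?_
  · rw [Fin.mem_piFinset_iff_zero_tail, Finset.mem_product]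
    rfl
  · simp [Fin.consEquiv]

variable {V : Type} [NumberFormat V]

theorem FiniteDist.sum_mass_mul (d : FiniteDist V) (G : ℚ → ℚ) :
    ∑ q ∈ d.values, d.mass q * G q = integral toRat d.pairs fun v => G (toRat v) :=
  sum_fiberwise d.pairs (fun e => toRat e.1) (fun e => toRat e.2) G

theorem expect_ofFn {n : ℕ} (d : Fin n → FiniteDist V) (m : Fin n → V → α) (F : List α → ℚ)
    (G : (Fin n → ℚ) → ℚ)
    (h : ∀ w : Fin n → V, F (List.ofFn fun j => m j (w j)) = G fun j => toRat (w j)) :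
    expect (List.ofFn fun j => (d j).pairs.map fun e => (m j e.1, e.2)) F =
      ∑ u ∈ Fintype.piFinset fun j => (d j).values, (∏ j, (d j).mass (u j)) * G u := by
  induction n generalizing F with
  | zero =>
    have hG (u : Fin 0 → ℚ) : G u = F [] :=
      (congrArg G (Subsingleton.elim _ _)).trans (h Fin.elim0).symm
    simp [expect, hG]
  | succ n ih =>
    have htail (v : V) := ih (fun j => d j.succ) (fun j => m j.succ) (fun o => F (m 0 v :: o))
      (fun u => G (Fin.cons (toRat v) u)) fun w => by
        have hcons : (fun j => toRat ((Fin.cons v w : Fin (n + 1) → V) j)) =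
            Fin.cons (toRat v) fun j => toRat (w j) := Fin.comp_cons (toRat : V → ℚ) v w
        simpa [List.ofFn_succ, hcons] using h (Fin.cons v w)
    rw [sum_piFinset_succ]
    simp only [Fin.prod_univ_succ, Fin.cons_zero, Fin.cons_succ, mul_assoc, ← Finset.mul_sum]
    rw [FiniteDist.sum_mass_mul, List.ofFn_succ, expect]
    simp [integral, Function.comp_def, htail]

end Expect

section Answer

variable {α σ : Type} (acc : σ → Bool) (upd : α → σ → σ) (base : σ)

/-- The total weight of the accepted states. -/
def weight (t : Table σ) : ℤ := ((t.filter fun e => acc e.1).map Prod.snd).sum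

theorem weight_eq_integral (t : Table σ) :
    (weight acc t : ℚ) = integral (↑) t fun s => if acc s then 1 else 0 := by
  induction t with
  | nil => rfl
  | cons e t ih =>
    rw [integral_cons, ← ih]
    cases h : acc e.1 <;> simp [weight, h]

variable [DecidableEq σ]

/-- The probability that the state reached from `base` by independent outcomes with the given
laws is accepted. -/
def answer (laws : List (Law α)) : Fraction where
  num := weight acc (table upd base (laws.map numerators))
  den := (laws.map commonDenominator).prod
  den_ne_zero := List.prod_ne_zero fun h => by
    obtain ⟨d, -, hd⟩ := List.mem_map.1 h
    exact commonDenominator_ne_zero d hd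

theorem toRat_answer (laws : List (Law α)) :
    toRat (answer acc upd base laws) =
      expect laws fun o => if acc (o.foldr upd base) then 1 else 0 := by
  have hden : ((laws.map commonDenominator).prod : ℚ) ≠ 0 :=
    mod_cast (answer acc upd base laws).den_ne_zero
  change (weight acc _ : ℚ) / ((laws.map commonDenominator).prod : ℤ) = _
  rw [weight_eq_integral, integral_table, mul_div_cancel_left₀ _ hden]

end Answer

end Prec

/-! ### Solving the precedence problem -/

namespace Prec

open Coded NumberFormat PolyTimeFormat

namespace PolyTime

variable {α σ : Type} [Coded α] [Coded σ]

theorem weight {γ : Type} [Coded γ] {acc : σ → Bool} (hacc : PolyTime acc)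
    {t : γ → Table σ} (ht : PolyTime t) :
    PolyTime fun x => weight acc (t x) := by
  unfold Prec.weight
  fun_prop

variable [DecidableEq σ] [PolyTimeEq σ]

theorem answer {acc : σ → Bool} (hacc : PolyTime acc) {upd : α → σ → σ}
    (hupd : PolyTime fun p : α × σ => upd p.1 p.2) {base : σ} {K : List (Law α) → ℕ → Finset σ}
    {N : List (Law α) → ℕ} (hN : PolyBounded N)
    (hcard : ∀ laws, ∀ n ≤ laws.length, (K laws n).card ≤ N laws)
    (hsize : ∀ laws, ∀ n ≤ laws.length, ∀ s ∈ K laws n, size s ≤ N laws)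
    (hbase : ∀ laws, base ∈ K laws 0)
    (hstep : ∀ laws, ∀ d ∈ laws, ∀ e ∈ d, ∀ n, ∀ s ∈ K laws n, upd e.1 s ∈ K laws (n + 1)) :
    PolyTime (answer acc upd base) := by
  refine fraction_mk (weight hacc (table hupd base (K := K) (by fun_prop) hN ?_ ?_ hbase ?_))
    (by fun_prop) _
  · simpa only [List.length_map] using hcard
  · simpa only [List.length_map] using hsize
  · intro laws c hc e he
    obtain ⟨d, hd, rfl⟩ := List.mem_map.1 hc
    have he' : e.1 ∈ d.map Prod.fst := map_fst_numerators d ▸ List.mem_map_of_mem he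
    obtain ⟨e', he', heq⟩ := List.mem_map.1 he'
    exact heq ▸ hstep laws d hd e' he'

end PolyTime

section Reduction

variable {V σ : Type} [NumberFormat V] [Coded V] [Mul V] [PolyTimeFormat V] [DecidableEq σ]

theorem precInPolyTime_of_answer {acc : σ → Bool} {upd : V × V → σ → σ} {base : σ}
    (hanswer : PolyTime (answer acc upd base)) {r : RankingFunction}
    (hr : ∀ (m : ℕ) (M : Matrix (Fin 2) (Fin m) V),
      acc ((List.ofFn fun j => (M 0 j, M 1 j)).foldr upd base) = true ↔
        r 2 m (M.map toRat) 0 < r 2 m (M.map toRat) 1) :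
    PrecInPolyTime V r := by
  refine ⟨fun x => answer acc upd base (List.ofFn x.column), fun x => ?_, ?_⟩
  · rw [toRat_answer]
    refine (expect_ofFn x.dist (fun j v => (x.matrix 0 j * v, x.matrix 1 j * v)) _
      (fun u => if r 2 x.cols (x.weighted u) 0 < r 2 x.cols (x.weighted u) 1 then 1 else 0)
      fun w => ?_).trans ?_
    · have hweighted : (Matrix.of fun i j => x.matrix i j * w j).map toRat =
          x.weighted fun j => toRat (w j) := by
        ext i j
        exact toRat_mul _ _
      have hacc := hr x.cols (Matrix.of fun i j => x.matrix i j * w j)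
      rw [hweighted] at hacc
      exact if_congr hacc rfl rfl
    · simp only [Input.precProb, mul_ite, mul_one, mul_zero]
  · refine (hanswer.comp PolyTime.decodeInput).encode_fraction.nonempty_tm2ComputableInPolyTime
      fun x => ?_
    rw [Input.decodeInput_encode]

end Reduction

section Candidates

variable {α β : Type}

/-- The states given by the first component of a pair in `l` and the second component of a pair
in `l`, and the initial state `none`. -/
def candidates (l : List (α × β)) : List (Option (α × β)) :=
  none :: l.flatMap fun p => l.map fun q => some (p.1, q.2)

theorem mem_candidates {l : List (α × β)} {s : Option (α × β)} :
    s ∈ candidates l ↔ ∀ p ∈ s, p.1 ∈ l.map Prod.fst ∧ p.2 ∈ l.map Prod.snd := by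
  rcases s with _ | ⟨a, b⟩ <;> simp [candidates]

variable [Coded α] [Coded β]

@[fun_prop]
theorem PolyTime.candidates {γ : Type} [Coded γ] {l : γ → List (α × β)} (hl : PolyTime l) :
    PolyTime fun x => candidates (l x) := by
  unfold Prec.candidates
  fun_prop

variable [DecidableEq α] [DecidableEq β] [PolyTimeEq α] [PolyTimeEq β]

theorem PolyTime.answer_option {acc : Option (α × β) → Bool} (hacc : PolyTime acc)
    {upd : α × β → Option (α × β) → Option (α × β)}
    (hupd : PolyTime fun p : (α × β) × Option (α × β) => upd p.1 p.2)
    (h : ∀ c s, ∀ p ∈ upd c s,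
      (p.1 = c.1 ∨ ∃ q ∈ s, p.1 = q.1) ∧ (p.2 = c.2 ∨ ∃ q ∈ s, p.2 = q.2)) :
    PolyTime (Prec.answer acc upd none) := by
  have hK : PolyTime fun laws : List (Law (α × β)) =>
      Prec.candidates (laws.flatMap fun d => d.map Prod.fst) := by fun_prop
  refine answer hacc hupd
    (K := fun laws _ => (Prec.candidates (laws.flatMap fun d => d.map Prod.fst)).toFinset)
    hK.polyBounded_size (fun laws _ _ => ?_) (fun laws _ _ s hs => ?_) (fun laws => ?_)
    fun laws d hd e he _ s hs => ?_
  · exact (List.toFinset_card_le _).trans (length_lt_size _).le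
  · exact (size_lt_of_mem (List.mem_toFinset.1 hs)).le
  · exact List.mem_toFinset.2 (mem_candidates.2 nofun)
  · have he' : e.1 ∈ laws.flatMap fun d => d.map Prod.fst :=
      List.mem_flatMap.2 ⟨d, hd, List.mem_map_of_mem he⟩
    rw [List.mem_toFinset, mem_candidates] at hs ⊢
    intro p hp
    obtain ⟨hfst, hsnd⟩ := h e.1 s p hp
    constructor
    · rcases hfst with hfst | ⟨q, hq, hfst⟩
      exacts [hfst ▸ List.mem_map_of_mem he', hfst ▸ (hs q hq).1]
    · rcases hsnd with hsnd | ⟨q, hq, hsnd⟩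
      exacts [hsnd ▸ List.mem_map_of_mem he', hsnd ▸ (hs q hq).2]

end Candidates

end Prec

/-! ### Ranking two rows -/

namespace Prec

open Coded NumberFormat PolyTimeFormat

theorem rankByKey_lt_iff {α : Type} [LinearOrder α] {n : ℕ} (key : Fin n → α) (i j : Fin n) :
    rankByKey key i < rankByKey key j ↔ key i < key j ∨ key i = key j ∧ i < j :=
  ((Tuple.graphEquiv₂ key).symm.lt_iff_lt (x := Tuple.graphEquiv₁ key i)
    (y := Tuple.graphEquiv₁ key j)).trans Prod.Lex.lt_iff

theorem rankByKey_zero_lt_one_iff {α : Type} [LinearOrder α] (key : Fin 2 → α) :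
    rankByKey key 0 < rankByKey key 1 ↔ key 0 ≤ key 1 := by
  rw [rankByKey_lt_iff, le_iff_lt_or_eq, and_iff_left Fin.zero_lt_one]

section Rules

variable {V : Type} [NumberFormat V]

/-- The entry of larger value. -/
def maxRat (v w : V) : V := bif leRat v w then w else v

/-- The row maxima after one more column. -/
def maxColumn (c : V × V) (s : Option (V × V)) : Option (V × V) :=
  s.elim (some c) fun p => some (maxRat c.1 p.1, maxRat c.2 p.2)

/-- The first column with two different entries after one more column has been put in front. -/
def lexColumn (c : V × V) (s : Option (V × V)) : Option (V × V) :=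
  bif leRat c.1 c.2 && leRat c.2 c.1 then s else some c

/-- The row sums after one more column. -/
def sumColumn (c : UnaryInt × UnaryInt) (s : ℤ × ℤ) : ℤ × ℤ := (c.1.toInt + s.1, c.2.toInt + s.2)

theorem maxRat_eq_or (v w : V) : maxRat v w = v ∨ maxRat v w = w := by
  cases h : leRat v w <;> simp [maxRat, h]

theorem toRat_maxRat (v w : V) : toRat (maxRat v w) = max (toRat v) (toRat w) := by
  by_cases h : toRat v ≤ toRat w
  · simp [maxRat, leRat, h]
  · simp [maxRat, leRat, h, (not_le.1 h).le]

theorem elim_leRat_iff {α : Type} (s : Option α) (f g : α → V) :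
    s.elim true (fun p => leRat (f p) (g p)) = true ↔
      s.elim ⊥ (fun p => (toRat (f p) : WithBot ℚ)) ≤
        s.elim ⊥ fun p => (toRat (g p) : WithBot ℚ) := by
  cases s <;> simp [leRat]

theorem scoreMax_succ {n : ℕ} (a : Fin (n + 1) → ℚ) :
    scoreMax a = max (a 0 : WithBot ℚ) (scoreMax fun j => a j.succ) := by
  have himage :
      Finset.univ.image a = insert (a 0) (Finset.univ.image fun j : Fin n => a j.succ) := by
    ext q
    simp [Fin.exists_fin_succ, eq_comm]
  rw [scoreMax, himage, Finset.max_insert]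
  rfl

theorem elim_foldr_maxColumn {n : ℕ} (a b : Fin n → V) :
    let s := (List.ofFn fun j => (a j, b j)).foldr maxColumn none
    s.elim ⊥ (fun p => (toRat p.1 : WithBot ℚ)) = scoreMax (fun j => toRat (a j)) ∧
      s.elim ⊥ (fun p => (toRat p.2 : WithBot ℚ)) = scoreMax fun j => toRat (b j) := by
  induction n with
  | zero => exact ⟨rfl, rfl⟩
  | succ n ih =>
    have ih := ih (fun j => a j.succ) fun j => b j.succ
    dsimp only at ih
    rw [scoreMax_succ, scoreMax_succ, ← ih.1, ← ih.2, List.ofFn_succ, List.foldr_cons]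
    cases (List.ofFn fun j : Fin n => (a j.succ, b j.succ)).foldr maxColumn none with
    | none => simp [maxColumn]
    | some p => simp [maxColumn, toRat_maxRat]

theorem toLex_succ_le_iff {n : ℕ} (a b : Fin (n + 1) → ℚ) :
    toLex a ≤ toLex b ↔ a 0 < b 0 ∨ a 0 = b 0 ∧
      toLex (fun j : Fin n => a j.succ) ≤ toLex fun j => b j.succ := by
  have hlt : toLex a < toLex b ↔ a 0 < b 0 ∨ a 0 = b 0 ∧
      toLex (fun j : Fin n => a j.succ) < toLex fun j => b j.succ := by
    have h := Fin.pi_lex_lt_cons_cons (α := fun _ : Fin (n + 1) => ℚ) (x₀ := a 0) (y₀ := b 0)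
      (x := Fin.tail a) (y := Fin.tail b) fun {_} => (· < ·)
    rwa [Fin.cons_self_tail, Fin.cons_self_tail] at h
  have heq : toLex a = toLex b ↔ a 0 = b 0 ∧
      toLex (fun j : Fin n => a j.succ) = toLex fun j => b j.succ := by
    simp only [toLex_inj, funext_iff, Fin.forall_fin_succ]
  refine le_iff_lt_or_eq.trans ((or_congr hlt heq).trans ?_)
  rw [or_assoc, ← and_or_left]
  exact or_congr_right (and_congr_right' le_iff_lt_or_eq.symm)

theorem elim_foldr_lexColumn {n : ℕ} (a b : Fin n → V) :
    ((List.ofFn fun j => (a j, b j)).foldr lexColumn none).elim true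
        (fun p => leRat p.1 p.2) = true ↔
      toLex (fun j => toRat (a j)) ≤ toLex fun j => toRat (b j) := by
  induction n with
  | zero => exact iff_of_true rfl (le_of_eq (Subsingleton.elim _ _))
  | succ n ih =>
    rw [toLex_succ_le_iff, ← ih (fun j => a j.succ) fun j => b j.succ, List.ofFn_succ,
      List.foldr_cons, lexColumn]
    rcases lt_trichotomy (toRat (a 0)) (toRat (b 0)) with h | h | h
    · simp [leRat, h, h.le, h.not_ge]
    · simp [leRat, h]
    · simp [leRat, h.le, h.not_ge, h.not_gt, h.ne']

theorem foldr_sumColumn {n : ℕ} (a b : Fin n → UnaryInt) :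
    (List.ofFn fun j => (a j, b j)).foldr sumColumn (0, 0) =
      (∑ j, (a j).toInt, ∑ j, (b j).toInt) := by
  induction n with
  | zero => rfl
  | succ n ih =>
    rw [List.ofFn_succ, List.foldr_cons, ih (fun j => a j.succ) fun j => b j.succ, sumColumn,
      Fin.sum_univ_succ, Fin.sum_univ_succ]

section Solvable

variable [Coded V] [Mul V] [PolyTimeFormat V]

namespace PolyTime

variable {α : Type} [Coded α]

@[fun_prop]
theorem maxRat {v w : α → V} (hv : PolyTime v) (hw : PolyTime w) :
    PolyTime fun x => maxRat (v x) (w x) := by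
  unfold Prec.maxRat
  fun_prop

theorem maxColumn : PolyTime fun p : (V × V) × Option (V × V) => maxColumn p.1 p.2 := by
  unfold Prec.maxColumn
  exact option_elim (by fun_prop) (by fun_prop) (by fun_prop)

theorem lexColumn : PolyTime fun p : (V × V) × Option (V × V) => lexColumn p.1 p.2 := by
  unfold Prec.lexColumn
  fun_prop

variable [DecidableEq V] [PolyTimeEq V]

theorem answer_maxColumn {acc : Option (V × V) → Bool} (hacc : PolyTime acc) :
    PolyTime (Prec.answer acc (Prec.maxColumn (V := V)) none) := by
  refine answer_option hacc maxColumn fun c s p hp => ?_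
  cases s with
  | none =>
    obtain rfl : c = p := Option.some.inj hp
    exact ⟨.inl rfl, .inl rfl⟩
  | some q =>
    obtain rfl : (Prec.maxRat c.1 q.1, Prec.maxRat c.2 q.2) = p := Option.some.inj hp
    exact ⟨(maxRat_eq_or c.1 q.1).imp_right fun h => ⟨q, rfl, h⟩,
      (maxRat_eq_or c.2 q.2).imp_right fun h => ⟨q, rfl, h⟩⟩

theorem answer_lexColumn {acc : Option (V × V) → Bool} (hacc : PolyTime acc) :
    PolyTime (Prec.answer acc (Prec.lexColumn (V := V)) none) := by
  refine answer_option hacc lexColumn fun c s p hp => ?_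
  rw [Prec.lexColumn] at hp
  cases h : (Prec.leRat c.1 c.2 && Prec.leRat c.2 c.1) with
  | true =>
    rw [h] at hp
    exact ⟨.inr ⟨p, hp, rfl⟩, .inr ⟨p, hp, rfl⟩⟩
  | false =>
    rw [h] at hp
    obtain rfl : c = p := Option.some.inj hp
    exact ⟨.inl rfl, .inl rfl⟩

end PolyTime

variable [DecidableEq V] [PolyTimeEq V]

theorem precInPolyTime_rankMaxAsc : PrecInPolyTime V rankMaxAsc := by
  have hacc : PolyTime fun s : Option (V × V) => s.elim true fun p => leRat p.1 p.2 :=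
    PolyTime.option_elim (by fun_prop) (by fun_prop) (by fun_prop)
  refine precInPolyTime_of_answer (PolyTime.answer_maxColumn hacc) fun m M => ?_
  obtain ⟨h0, h1⟩ := elim_foldr_maxColumn (M 0) (M 1)
  rw [elim_leRat_iff, h0, h1]
  exact (rankByKey_zero_lt_one_iff fun i => scoreMax (M.map toRat i)).symm

theorem precInPolyTime_rankMaxDsc : PrecInPolyTime V rankMaxDsc := by
  have hacc : PolyTime fun s : Option (V × V) => s.elim true fun p => leRat p.2 p.1 :=
    PolyTime.option_elim (by fun_prop) (by fun_prop) (by fun_prop)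
  refine precInPolyTime_of_answer (PolyTime.answer_maxColumn hacc) fun m M => ?_
  obtain ⟨h0, h1⟩ := elim_foldr_maxColumn (M 0) (M 1)
  rw [elim_leRat_iff, h0, h1]
  exact (rankByKey_zero_lt_one_iff fun i => OrderDual.toDual (scoreMax (M.map toRat i))).symm

theorem precInPolyTime_rankLex : PrecInPolyTime V rankLex := by
  have hacc : PolyTime fun s : Option (V × V) => s.elim true fun p => leRat p.1 p.2 :=
    PolyTime.option_elim (by fun_prop) (by fun_prop) (by fun_prop)
  refine precInPolyTime_of_answer (PolyTime.answer_lexColumn hacc) fun m M => ?_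
  rw [elim_foldr_lexColumn]
  exact (rankByKey_zero_lt_one_iff fun i => toLex (M.map toRat i)).symm

end Solvable

section Unary

theorem size_int_le (z : ℤ) : size z ≤ 2 * z.natAbs + 3 := by
  have := Nat.size_le.2 (Nat.lt_two_pow_self (n := z.natAbs))
  rw [size_int]
  omega

theorem natAbs_toInt_le_of_mem {laws : List (Law (UnaryInt × UnaryInt))}
    {d : Law (UnaryInt × UnaryInt)} (hd : d ∈ laws) {e : (UnaryInt × UnaryInt) × Fraction}
    (he : e ∈ d) : e.1.1.toInt.natAbs ≤ size laws ∧ e.1.2.toInt.natAbs ≤ size laws := by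
  have h1 := natAbs_toInt_le_size e.1.1
  have h2 := natAbs_toInt_le_size e.1.2
  have he := size_lt_of_mem he
  have hd := size_lt_of_mem hd
  rw [size_prod e, size_prod e.1] at he
  omega

theorem PolyTime.sumColumn :
    PolyTime fun p : (UnaryInt × UnaryInt) × ℤ × ℤ => sumColumn p.1 p.2 := by
  unfold Prec.sumColumn
  fun_prop

/-- The pairs of integers of absolute value at most `k`. -/
noncomputable def box (k : ℕ) : Finset (ℤ × ℤ) := Finset.Icc (-k : ℤ) k ×ˢ Finset.Icc (-k : ℤ) k

theorem mem_box {k : ℕ} {s : ℤ × ℤ} : s ∈ box k ↔ s.1.natAbs ≤ k ∧ s.2.natAbs ≤ k := by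
  simp only [box, Finset.mem_product, Finset.mem_Icc]
  omega

theorem card_box (k : ℕ) : (box k).card = (2 * k + 1) * (2 * k + 1) := by
  have h : ((k : ℤ) + 1 - -k).toNat = 2 * k + 1 := by omega
  rw [box, Finset.card_product, Int.card_Icc, h]

theorem PolyTime.answer_sumColumn {acc : ℤ × ℤ → Bool} (hacc : PolyTime acc) :
    PolyTime (Prec.answer acc Prec.sumColumn (0, 0)) := by
  refine answer hacc sumColumn (K := fun laws n => box (n * size laws))
    (N := fun laws => (2 * (size laws * size laws) + 1) * (2 * (size laws * size laws) + 1) +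
      (4 * (size laws * size laws) + 7)) (by fun_prop) (fun laws n hn => ?_)
    (fun laws n hn s hs => ?_) (fun laws => by simp [mem_box]) fun laws d hd e he n s hs => ?_
  · have hn := Nat.mul_le_mul_right (size laws) (hn.trans (length_lt_size laws).le)
    rw [card_box]
    exact Nat.le_add_right_of_le (by gcongr)
  · have hn := Nat.mul_le_mul_right (size laws) (hn.trans (length_lt_size laws).le)
    have h1 := size_int_le s.1
    have h2 := size_int_le s.2
    rw [mem_box] at hs
    rw [size_prod]
    refine Nat.le_add_left_of_le ?_
    omega
  · have he := natAbs_toInt_le_of_mem hd he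
    rw [mem_box] at hs ⊢
    rw [add_mul, one_mul]
    dsimp only [Prec.sumColumn]
    omega

theorem precInPolyTime_rankSum : PrecInPolyTime UnaryInt rankSum := by
  refine precInPolyTime_of_answer (acc := fun s => decide (s.1 ≤ s.2))
    (PolyTime.answer_sumColumn (by fun_prop)) fun m M => ?_
  have hsum (i : Fin 2) : scoreSum (M.map toRat i) = (∑ j, (M i j).toInt : ℤ) :=
    (Int.cast_sum _ _).symm
  rw [foldr_sumColumn, decide_eq_true_iff, rankSum, rankByKey_zero_lt_one_iff, hsum, hsum,
    Int.cast_le]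

end Unary

end Rules

end Prec

theorem mainTheorem1 :
    Prec.PrecInPolyTime Prec.Fraction Prec.rankMaxAsc ∧
    Prec.PrecInPolyTime Prec.Fraction Prec.rankMaxDsc ∧
    Prec.PrecInPolyTime Prec.Fraction Prec.rankLex ∧
    Prec.PrecInPolyTime Prec.UnaryInt Prec.rankSum :=
  ⟨Prec.precInPolyTime_rankMaxAsc, Prec.precInPolyTime_rankMaxDsc, Prec.precInPolyTime_rankLex,
    Prec.precInPolyTime_rankSum⟩
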